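/- Let a qubit with Hamiltonian $\hat H_S=\omega|1\rangle\langle 1|$, $\omega>0$, in an arbitrary state $\hat\rho_S$ be coupled to a weight with Hilbert space $L^2(\mathbb R)$, whose Hamiltonian $\hat H_W$ is multiplication by the energy $E$, in a state $\hat\rho_W$ with finite energy variance and $\langle \hat H_W\rangle_{\hat\rho_W}=0$. Let $\hat\Delta_W=-i\,d/dE$ and $\hat S=e^{-i\hat H_S\otimes\hat\Delta_W}$. A work extraction protocol is the map $\hat\rho_S\otimes\hat\rho_W\mapsto \hat U(\hat\rho_S\otimes\hat\rho_W)\hat U^\dagger$ with $\hat U=\hat S^\dagger\hat V_S\hat S$ and $\hat V_S$ a unitary on the qubit; $\Delta E_W$ and $\Delta\sigma_W^2$ denote the resulting changes of the mean and of the variance of the energy of the weight. Let $$W(E,t)=\frac1{2\pi}\int d\nu\, e^{i\nu t}\,\langle E-\tfrac\nu2|\hat\rho_W|E+\tfrac\nu2\rangle$$ be the Wigner function of $\hat\rho_W$. Let the control-marginal state $\hat\sigma_S=\mathrm{Tr}_W[\hat S(\hat\rho_S\otimes\hat\rho_W)\hat S^\dagger]$ have the diagonal form $\hat\sigma_S=p|\psi_0\rangle\langle\psi_0|+(1-p)|\psi_1\rangle\langle\psi_1|$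 with $\psi_0,\psi_1$ orthonormal and $p<\tfrac12$, and put $\varepsilon_i=\frac1\omega\langle\psi_i|\hat H_S|\psi_i\rangle$. Let $$\gamma=\int dt\int dE\,W(E,t)e^{i\omega t},\qquad \eta=\frac1\omega\int dt\int dE\,E\,W(E,t)\Big(\frac{e^{i\omega t}}{\gamma}+\frac{e^{-i\omega t}}{\gamma^*}\Big),$$ $$\xi=\frac1\omega\int dt\int dE\,E\,W(E,t)\Big(\frac{\varepsilon_1e^{i\omega t}}{\gamma}-\frac{\varepsilon_0e^{-i\omega t}}{\gamma^*}\Big),$$ where $\gamma\neq0$ and the integral of $E\,W(E,t)$ is assumed to exist (for almost every $t$ the function $E\mapsto E\,W(E,t)$ is integrable, and $t\mapsto\int E\,W(E,t)\,dE$ is integrable). Define $$f(w)=-w^2+\Big(\frac{\varepsilon_1-\varepsilon_0}{1-2p}+4\varepsilon_0\varepsilon_1\eta\Big)w+2\varepsilon_0\varepsilon_1\big[1-(1-2p)(\varepsilon_1-\varepsilon_0)\eta\big],$$ $$h(w)=2R\sqrt{\varepsilon_0\varepsilon_1\Big(\varepsilon_0+\frac{w}{1-2p}\Big)\Big(\varepsilon_1-\frac{w}{1-2p}\Big)},\qquad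 R=\big|1-2(1-2p)\xi\big|.$$ Then $\eta$ is real, the energy variance of the weight after every protocol is finite, and, as $\hat V_S$ ranges over all unitaries on the qubit, the set of pairs $(\Delta E_W/\omega,\ \Delta\sigma_W^2/\omega^2)$ is exactly $$\big\{(w,v):\ w\in[-\varepsilon_0(1-2p),\,\varepsilon_1(1-2p)],\ \ v\in[f(w)-h(w),\,f(w)+h(w)]\big\}.$$ -/

import Mathlib

open MeasureTheory
open scoped ComplexOrder

noncomputable section

namespace QubitWeight

/-! ### States of the weight

The weight has the Hilbert space `L²(ℝ)` in the energy representation, so that its Hamiltonian `H_W`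
is multiplication by the energy `E`. -/

/-- A state (density operator) `ρ_W = ∑ₙ qₙ |φₙ⟩⟨φₙ|` of the weight: nonnegative probabilities `qₙ`
of total mass one and unit vectors `φₙ` of `L²(ℝ)`. -/
structure WeightState where
  /-- the probabilities `qₙ` -/
  prob : ℕ → ℝ
  /-- the wave functions `φₙ` in the energy representation -/
  wave : ℕ → ℝ → ℂ
  prob_nonneg : ∀ n, 0 ≤ prob n
  hasSum_prob : HasSum prob 1
  memLp_wave : ∀ n, MemLp (wave n) 2 volume
  norm_wave : ∀ n, ∫ E, ‖wave n E‖ ^ 2 = 1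

/-- The matrix element `⟨E₁| ρ_W |E₂⟩`. -/
def WeightState.kernel (ρW : WeightState) (E₁ E₂ : ℝ) : ℂ :=
  ∑' n, (ρW.prob n : ℂ) * ρW.wave n E₁ * star (ρW.wave n E₂)

/-- The energy distribution `f(E) = ⟨E| ρ_W |E⟩`. -/
def WeightState.energyDensity (ρW : WeightState) (E : ℝ) : ℝ :=
  (ρW.kernel E E).re

/-- The Wigner function
`W(E,t) = (1/2π) ∫ dν e^{iνt} Tr[ρ_W |E + ν/2⟩⟨E - ν/2|]`. -/
def WeightState.wigner (ρW : WeightState) (E t : ℝ) : ℂ :=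
  (1 / (2 * Real.pi) : ℂ) *
    ∫ ν : ℝ, Complex.exp (Complex.I * ν * t) * ρW.kernel (E - ν / 2) (E + ν / 2)

/-! ### Mean and variance of an energy distribution -/

/-- `∫ E f(E) dE` -/
def mean (f : ℝ → ℝ) : ℝ := ∫ E, E * f E

/-- `∫ E² f(E) dE - (∫ E f(E) dE)²` -/
def variance (f : ℝ → ℝ) : ℝ := (∫ E, E ^ 2 * f E) - (∫ E, E * f E) ^ 2

/-- The second moment of the distribution exists. -/
def FiniteSecondMoment (f : ℝ → ℝ) : Prop := Integrable fun E => E ^ 2 * f E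

/-! ### The qubit and the composite system

The composite Hilbert space is `ℂ² ⊗ L²(ℝ)`; its vectors are wave functions of the pair `(E, i)`. -/

/-- The energy levels `0` and `ω` of the qubit. -/
def level (ω : ℝ) : Fin 2 → ℝ := ![0, ω]

/-- The qubit Hamiltonian `H_S = ω |1⟩⟨1|`. -/
def hamiltonian (ω : ℝ) : Matrix (Fin 2) (Fin 2) ℂ :=
  Matrix.diagonal fun i => (level ω i : ℂ)

/-- Wave functions of the composite system. -/
abbrev WaveFunction := ℝ × Fin 2 → ℂ

/-- Operator kernels `⟨E₁, i| ρ |E₂, j⟩` on the composite system. -/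
abbrev OpKernel := ℝ × Fin 2 → ℝ × Fin 2 → ℂ

/-- `e^{-i s H_S ⊗ Δ_W}`: as `Δ_W = -i d/dE`, this displaces the energy of the weight by `s ε_i`
if the qubit is in the energy eigenstate `|i⟩`. -/
def controlledShift (ω s : ℝ) (Ψ : WaveFunction) : WaveFunction :=
  fun x => Ψ (x.1 - s * level ω x.2, x.2)

/-- A qubit operator `V_S`, acting on the composite system as `V_S ⊗ 1`. -/
def onQubit (V : Matrix (Fin 2) (Fin 2) ℂ) (Ψ : WaveFunction) : WaveFunction :=
  fun x => ∑ j, V x.2 j * Ψ (x.1, j)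

/-- The operator `S = e^{-i H_S ⊗ Δ_W}`. -/
def opS (ω : ℝ) : WaveFunction → WaveFunction := controlledShift ω 1

/-- The operator `S† = e^{i H_S ⊗ Δ_W}`. -/
def opSDagger (ω : ℝ) : WaveFunction → WaveFunction := controlledShift ω (-1)

/-- The unitary `U = S† V_S S` of a work extraction protocol. -/
def protocolU (ω : ℝ) (V : Matrix (Fin 2) (Fin 2) ℂ) : WaveFunction → WaveFunction :=
  fun Ψ => opSDagger ω (onQubit V (opS ω Ψ))

/-- The kernel of the adjoint `K†`. -/
def adj (K : OpKernel) : OpKernel := fun x y => star (K y x)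

/-- The kernel of `A K`. -/
def mulLeft (A : WaveFunction → WaveFunction) (K : OpKernel) : OpKernel :=
  fun x y => A (fun z => K z y) x

/-- The kernel of `A K A† = (A (A K)†)†`. -/
def conjugate (A : WaveFunction → WaveFunction) (K : OpKernel) : OpKernel :=
  adj (mulLeft A (adj (mulLeft A K)))

/-- The product state `ρ_S ⊗ ρ_W`. -/
def productState (ρS : Matrix (Fin 2) (Fin 2) ℂ) (ρW : WeightState) : OpKernel :=
  fun x y => ρS x.2 y.2 * ρW.kernel x.1 y.1

/-- The energy distribution `∑ᵢ ⟨E, i| ρ |E, i⟩` of the weight in a state of the composite system. -/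
def weightEnergyDensity (K : OpKernel) (E : ℝ) : ℝ := ∑ i, (K (E, i) (E, i)).re

/-- The partial trace over the weight. -/
def traceWeight (K : OpKernel) : Matrix (Fin 2) (Fin 2) ℂ :=
  Matrix.of fun i j => ∫ E, K (E, i) (E, j)

/-- The state `U (ρ_S ⊗ ρ_W) U†` after the protocol. -/
def finalState (ω : ℝ) (ρS : Matrix (Fin 2) (Fin 2) ℂ) (ρW : WeightState)
    (V : Matrix (Fin 2) (Fin 2) ℂ) : OpKernel :=
  conjugate (protocolU ω V) (productState ρS ρW)

/-- The change `ΔE_W` of the average energy of the weight. -/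
def deltaEnergy (ω : ℝ) (ρS : Matrix (Fin 2) (Fin 2) ℂ) (ρW : WeightState)
    (V : Matrix (Fin 2) (Fin 2) ℂ) : ℝ :=
  mean (weightEnergyDensity (finalState ω ρS ρW V)) -
    mean (weightEnergyDensity (productState ρS ρW))

/-- The change `Δσ_W²` of the energy variance of the weight. -/
def deltaVariance (ω : ℝ) (ρS : Matrix (Fin 2) (Fin 2) ℂ) (ρW : WeightState)
    (V : Matrix (Fin 2) (Fin 2) ℂ) : ℝ :=
  variance (weightEnergyDensity (finalState ω ρS ρW V)) -
    variance (weightEnergyDensity (productState ρS ρW))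

/-- The control-marginal state `σ_S = Tr_W[S (ρ_S ⊗ ρ_W) S†]`. -/
def controlMarginal (ω : ℝ) (ρS : Matrix (Fin 2) (Fin 2) ℂ) (ρW : WeightState) :
    Matrix (Fin 2) (Fin 2) ℂ :=
  traceWeight (conjugate (opS ω) (productState ρS ρW))

/-- The projector `|ψ⟩⟨ψ|`. -/
def projector (ψ : EuclideanSpace ℂ (Fin 2)) : Matrix (Fin 2) (Fin 2) ℂ :=
  Matrix.of fun i j => ψ i * star (ψ j)

/-- The dimensionless energy `ε = ⟨ψ| H_S |ψ⟩ / ω`. -/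
def relEnergy (ω : ℝ) (ψ : EuclideanSpace ℂ (Fin 2)) : ℝ :=
  (1 / ω) * (∑ i, ∑ j, star (ψ i) * hamiltonian ω i j * ψ j).re

/-! ### The Wigner integrals and the boundary of the work-variance phase space -/

/-- The integrals `∫ dt ∫ dE E W(E,t) c(t)` with a bounded factor `c(t)` exist. -/
def WeightState.WignerMomentExists (ρW : WeightState) : Prop :=
  (∀ᵐ t : ℝ, Integrable fun E : ℝ => (E : ℂ) * ρW.wigner E t) ∧
    Integrable fun t : ℝ => ∫ E : ℝ, (E : ℂ) * ρW.wigner E t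

/-- `γ = ∫ dt ∫ dE W(E,t) e^{iωt}` -/
def gammaInt (ω : ℝ) (ρW : WeightState) : ℂ :=
  ∫ t : ℝ, ∫ E : ℝ, ρW.wigner E t * Complex.exp (Complex.I * ω * t)

/-- `η = (1/ω) ∫ dt ∫ dE E W(E,t) (e^{iωt}/γ + e^{-iωt}/γ*)` -/
def etaInt (ω : ℝ) (ρW : WeightState) : ℂ :=
  (1 / ω : ℂ) * ∫ t : ℝ, ∫ E : ℝ, (E : ℂ) * ρW.wigner E t *
    (Complex.exp (Complex.I * ω * t) * (1 / gammaInt ω ρW) +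
      Complex.exp (-(Complex.I * ω * t)) * (1 / star (gammaInt ω ρW)))

/-- `ξ = (1/ω) ∫ dt ∫ dE E W(E,t) (e^{iωt} ε₁/γ - e^{-iωt} ε₀/γ*)` -/
def xiInt (ω ε₀ ε₁ : ℝ) (ρW : WeightState) : ℂ :=
  (1 / ω : ℂ) * ∫ t : ℝ, ∫ E : ℝ, (E : ℂ) * ρW.wigner E t *
    (Complex.exp (Complex.I * ω * t) * (ε₁ / gammaInt ω ρW) -
      Complex.exp (-(Complex.I * ω * t)) * (ε₀ / star (gammaInt ω ρW)))

/-- The centre `f(w)` of the range of variance changes. -/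
def fCentre (p ε₀ ε₁ η w : ℝ) : ℝ :=
  -w ^ 2 + ((ε₁ - ε₀) / (1 - 2 * p) + 4 * ε₀ * ε₁ * η) * w +
    2 * ε₀ * ε₁ * (1 - (1 - 2 * p) * (ε₁ - ε₀) * η)

/-- `R = |1 - 2 (1 - 2p) ξ|` -/
def radiusR (p : ℝ) (ξ : ℂ) : ℝ := ‖1 - 2 * (1 - 2 * (p : ℂ)) * ξ‖

/-- The half-width `h(w)` of the range of variance changes. -/
def hWidth (p ε₀ ε₁ : ℝ) (ξ : ℂ) (w : ℝ) : ℝ :=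
  2 * radiusR p ξ *
    Real.sqrt (ε₀ * ε₁ * (ε₀ + w / (1 - 2 * p)) * (ε₁ - w / (1 - 2 * p)))

end QubitWeight

end

/-
The translation-modulation covariance of the `L²` Fourier transform, with a Gaussian cutoff in
place of joint integrability, turns `∫ dt ∫ dE E W(E,t) e^{iωt}` into a moment of the coherences of
`ρ_W` between energies that differ by `ω`. Divided by `ωγ`, this moment is a number `μ`, and
`η = μ + μ*`, `ξ = ε₁ μ - ε₀ μ*`. In the eigenbasis of `σ_S` a protocol becomes a unitary `P`; the
changes of mean and variance depend on `P` only through the occupation `q = |P₁₀|²` and the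
interference term `Re (k P₁₀ P₁₁*)` with a constant `k` of modulus `R √(ε₀ ε₁)`. The former fixes
`w`, and the latter fills the interval `|·| ≤ |k| √(q (1 - q))`, whence the half-width `h`.
-/

noncomputable section

namespace QubitWeight

open scoped FourierTransform InnerProductSpace SchwartzMap ENNReal ComplexConjugate
open Real (fourierChar)
open DomAddAct (mk)
open Filter Topology

variable {V F : Type*} [NormedAddCommGroup V] [InnerProductSpace ℝ V] [FiniteDimensional ℝ V]
  [MeasurableSpace V] [BorelSpace V] [NormedAddCommGroup F] [InnerProductSpace ℂ F]

section FourierL2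

/-! ### Translations, modulations and the Fourier transform -/

lemma memLp_fourierChar_smul (h : V) {u : V → F} (hu : MemLp u 2 volume) :
    MemLp (fun x => fourierChar ⟪h, x⟫_ℝ • u x) 2 volume := by
  have hcont : Continuous fun x : V => (fourierChar ⟪h, x⟫_ℝ : ℂ) := by fun_prop
  exact hu.of_le (hcont.aestronglyMeasurable.smul hu.1)
    (Eventually.of_forall fun x => (Circle.norm_smul _ _).le)

/-- The modulation of `u ∈ L²(V; F)`: multiplication by the character `x ↦ e^{2πi⟨h, x⟩}`, the
counterpart of a translation under the Fourier transform. -/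
def modulate (h : V) (u : Lp F 2 (volume : Measure V)) : Lp F 2 (volume : Measure V) :=
  (memLp_fourierChar_smul h (Lp.memLp u)).toLp _

lemma coeFn_modulate (h : V) (u : Lp F 2 (volume : Measure V)) :
    modulate h u =ᵐ[volume] fun x => fourierChar ⟪h, x⟫_ℝ • u x :=
  MemLp.coeFn_toLp _

lemma isometry_modulate (h : V) :
    Isometry (modulate h : Lp F 2 (volume : Measure V) → Lp F 2 (volume : Measure V)) := by
  intro u v
  rw [Lp.edist_def, Lp.edist_def]
  refine eLpNorm_congr_norm_ae ?_
  filter_upwards [coeFn_modulate h u, coeFn_modulate h v] with x hu hv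
  rw [Pi.sub_apply, Pi.sub_apply, hu, hv, ← smul_sub, Circle.norm_smul]

lemma vadd_toLp_schwartz (h : V) (f : 𝓢(V, F)) :
    mk h +ᵥ f.toLp 2 volume = (f.compSubConstCLM ℂ (-h)).toLp 2 := by
  refine (DomAddAct.mk_vadd_toLp (μ := volume) h (f.memLp 2 volume)).trans (MemLp.toLp_congr _ _ ?_)
  refine Eventually.of_forall fun x => ?_
  change f (h + x) = f (x - -h)
  rw [sub_neg_eq_add, add_comm]

lemma fourier_compSubConst (h s : V) (f : 𝓢(V, F)) :
    𝓕 (f.compSubConstCLM ℂ (-h)) s = fourierChar ⟪h, s⟫_ℝ • 𝓕 f s := by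
  rw [SchwartzMap.fourier_coe, SchwartzMap.fourier_coe]
  have hcomp : ⇑(f.compSubConstCLM ℂ (-h)) = f ∘ fun x => x + h := by
    ext x
    rw [SchwartzMap.compSubConstCLM_apply, sub_neg_eq_add, Function.comp_apply]
  rw [hcomp]
  exact congrFun (VectorFourier.fourierIntegral_comp_add_right _ _ (innerₗ V) f h) s

lemma fourierInv_compSubConst (h s : V) (f : 𝓢(V, F)) :
    𝓕⁻ (f.compSubConstCLM ℂ (-h)) s = fourierChar ⟪-h, s⟫_ℝ • 𝓕⁻ f s := by
  rw [SchwartzMap.fourierInv_coe, SchwartzMap.fourierInv_coe, Real.fourierInv_eq_fourier_neg,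
    Real.fourierInv_eq_fourier_neg, ← SchwartzMap.fourier_coe, ← SchwartzMap.fourier_coe,
    fourier_compSubConst, inner_neg_left, inner_neg_right]

lemma eq_of_forall_schwartz {T₁ T₂ : Lp F 2 (volume : Measure V) → Lp F 2 (volume : Measure V)}
    (h₁ : Continuous T₁) (h₂ : Continuous T₂) (h : ∀ f : 𝓢(V, F), T₁ (f.toLp 2) = T₂ (f.toLp 2)) :
    T₁ = T₂ :=
  (SchwartzMap.denseRange_toLpCLM (p := 2) ENNReal.ofNat_ne_top).equalizer h₁ h₂ (funext h)

variable [CompleteSpace F]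

theorem fourier_vadd (h : V) (u : Lp F 2 (volume : Measure V)) :
    𝓕 (mk h +ᵥ u) = modulate h (𝓕 u) := by
  have hcont : Continuous (𝓕 : Lp F 2 (volume : Measure V) → Lp F 2 (volume : Measure V)) :=
    (Lp.fourierTransformₗᵢ V F).continuous
  refine congrFun (eq_of_forall_schwartz (T₁ := fun u => 𝓕 (mk h +ᵥ u))
    (hcont.comp (continuous_const_vadd _)) ((isometry_modulate h).continuous.comp hcont)
    fun f => ?_) u
  rw [Function.comp_apply, vadd_toLp_schwartz, SchwartzMap.toLp_fourier_eq,
    SchwartzMap.toLp_fourier_eq]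
  apply Lp.ext
  filter_upwards [(𝓕 (f.compSubConstCLM ℂ (-h))).coeFn_toLp 2 volume,
    (𝓕 f).coeFn_toLp 2 volume, coeFn_modulate h ((𝓕 f).toLp 2)] with x h₁ h₂ h₃
  rw [h₁, h₃, h₂, fourier_compSubConst]

theorem fourierInv_vadd (h : V) (u : Lp F 2 (volume : Measure V)) :
    𝓕⁻ (mk h +ᵥ u) = modulate (-h) (𝓕⁻ u) := by
  have hcont : Continuous (𝓕⁻ : Lp F 2 (volume : Measure V) → Lp F 2 (volume : Measure V)) :=
    (Lp.fourierTransformₗᵢ V F).symm.continuous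
  refine congrFun (eq_of_forall_schwartz (T₁ := fun u => 𝓕⁻ (mk h +ᵥ u))
    (hcont.comp (continuous_const_vadd _)) ((isometry_modulate (-h)).continuous.comp hcont)
    fun f => ?_) u
  rw [Function.comp_apply, vadd_toLp_schwartz, SchwartzMap.toLp_fourierInv_eq,
    SchwartzMap.toLp_fourierInv_eq]
  apply Lp.ext
  filter_upwards [(𝓕⁻ (f.compSubConstCLM ℂ (-h))).coeFn_toLp 2 volume,
    (𝓕⁻ f).coeFn_toLp 2 volume, coeFn_modulate (-h) ((𝓕⁻ f).toLp 2)] with x h₁ h₂ h₃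
  rw [h₁, h₃, h₂, fourierInv_compSubConst]

lemma vadd_fourier (h : V) (u : Lp F 2 (volume : Measure V)) :
    mk h +ᵥ 𝓕 u = 𝓕 (modulate (-h) u) := by
  refine (Lp.fourierTransformₗᵢ V F).symm.injective ?_
  change 𝓕⁻ (mk h +ᵥ 𝓕 u) = 𝓕⁻ (𝓕 (modulate (-h) u))
  rw [fourierInv_vadd, FourierTransform.fourierInv_fourier_eq (F := Lp F 2 volume),
    FourierTransform.fourierInv_fourier_eq (F := Lp F 2 volume)]

end FourierL2

section Inversion

variable [CompleteSpace F]

lemma integral_fourier_smul_eq {f : V → ℂ} {g : V → F} (hf : Integrable f) (hg : Integrable g) :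
    ∫ x, 𝓕 f x • g x = ∫ x, f x • 𝓕 g x := by
  have h := VectorFourier.integral_fourierIntegral_smul_eq_flip (L := innerₗ V)
    Real.continuous_fourierChar (by exact continuous_inner) hf hg
  rwa [flip_innerₗ] at h

theorem fourierInv_fourier_ae_eq {f : V → F} (hf : Integrable f) (hF : Integrable (𝓕 f)) :
    f =ᵐ[volume] 𝓕⁻ (𝓕 f) := by
  have hcont : Continuous (𝓕⁻ (𝓕 f)) := by
    rw [Real.fourierInv_eq_fourier_comp_neg]
    exact VectorFourier.fourierIntegral_continuous Real.continuous_fourierChar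
      (by exact continuous_inner) hF.comp_neg
  refine ae_eq_of_integral_contDiff_smul_eq hf.locallyIntegrable hcont.locallyIntegrable ?_
  intro φ hφ hφs
  have hs : HasCompactSupport fun x => (φ x : ℂ) := hφs.comp_left (g := Complex.ofReal) rfl
  let Φ : 𝓢(V, ℂ) := hs.toSchwartzMap (Complex.ofRealCLM.contDiff.comp hφ)
  have hΦ (x : V) (y : F) : φ x • y = Φ x • y := (Complex.coe_smul (φ x) y).symm
  simp only [hΦ]
  have hleft : ∫ x, Φ x • f x = ∫ x, 𝓕⁻ Φ x • 𝓕 f x := by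
    have h := integral_fourier_smul_eq (𝓕⁻ Φ).integrable hf
    rwa [← SchwartzMap.fourier_coe, FourierTransform.fourier_fourierInv_eq] at h
  have hright : ∫ x, Φ x • 𝓕⁻ (𝓕 f) x = ∫ x, 𝓕⁻ Φ x • 𝓕 f x := by
    rw [Real.fourierInv_eq_fourier_comp_neg,
      ← integral_fourier_smul_eq Φ.integrable hF.comp_neg, ← integral_neg_eq_self]
    simp only [neg_neg]
    rfl
  rw [hleft, hright]

end Inversion

section Weyl

lemma inner_circle_smul_circle_smul {H : Type*} [SeminormedAddCommGroup H] [InnerProductSpace ℂ H]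
    (c d : Circle) (x y : H) : ⟪c • x, d • y⟫_ℂ = (c⁻¹ * d) • ⟪x, y⟫_ℂ := by
  simp only [Circle.smul_def, inner_smul_left, inner_smul_right, Circle.coe_mul,
    Circle.coe_inv_eq_conj, smul_eq_mul]
  ring

lemma coeFn_vadd {G : Type*} [NormedAddCommGroup G] (h : V) (u : Lp G 2 (volume : Measure V)) :
    (mk h +ᵥ u : Lp G 2 (volume : Measure V)) =ᵐ[volume] fun x => u (x + h) := by
  filter_upwards [DomAddAct.vadd_Lp_ae_eq (mk h) u] with x hx
  rw [hx, add_comm]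
  rfl

lemma vadd_modulate (h k : V) (u : Lp F 2 (volume : Measure V)) :
    mk h +ᵥ modulate k u = (fourierChar ⟪k, h⟫_ℝ : ℂ) • modulate k (mk h +ᵥ u) := by
  apply Lp.ext
  filter_upwards [coeFn_vadd h (modulate k u), coeFn_vadd h u, coeFn_modulate k (mk h +ᵥ u),
    Lp.coeFn_smul (fourierChar ⟪k, h⟫_ℝ : ℂ) (modulate k (mk h +ᵥ u)),
    (measurePreserving_add_right volume h).quasiMeasurePreserving.ae (coeFn_modulate k u)]
    with x h₁ h₂ h₃ h₄ h₅
  rw [h₁, h₅, h₄, Pi.smul_apply, h₃, h₂, ← Circle.smul_def, smul_smul, ← AddChar.map_add_eq_mul,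
    inner_add_right, add_comm]

lemma inner_modulate_vadd (h k : V) (u v : Lp F 2 (volume : Measure V)) :
    ⟪modulate (-h) (mk k +ᵥ u), modulate h (mk (-k) +ᵥ v)⟫_ℂ =
      ∫ x, fourierChar ⟪(2 : ℝ) • h, x⟫_ℝ • ⟪u (x + k), v (x - k)⟫_ℂ := by
  rw [L2.inner_def]
  refine integral_congr_ae ?_
  filter_upwards [coeFn_vadd k u, coeFn_vadd (-k) v, coeFn_modulate (-h) (mk k +ᵥ u),
    coeFn_modulate h (mk (-k) +ᵥ v)] with x h₁ h₂ h₃ h₄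
  rw [h₃, h₄, h₁, h₂, inner_circle_smul_circle_smul, ← AddChar.map_neg_eq_inv,
    ← AddChar.map_add_eq_mul, ← sub_eq_add_neg, inner_neg_left, neg_neg, real_inner_smul_left,
    two_mul]

variable [CompleteSpace F]

lemma inner_modulate_vadd_fourier (h k : V) (u v : Lp F 2 (volume : Measure V)) :
    ⟪modulate k (mk h +ᵥ 𝓕 u), modulate (-k) (mk (-h) +ᵥ 𝓕 v)⟫_ℂ =
      ⟪modulate (-h) (mk k +ᵥ u), modulate h (mk (-k) +ᵥ v)⟫_ℂ := by
  have hphase := Circle.normSq_coe (fourierChar ⟪k, h⟫_ℝ)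
  rw [← Lp.inner_fourier_eq (modulate (-h) _), ← vadd_fourier, fourier_vadd, ← neg_neg h,
    ← vadd_fourier, neg_neg, fourier_vadd, vadd_modulate, vadd_modulate, inner_smul_left,
    inner_smul_right, inner_neg_neg, ← mul_assoc, mul_comm (conj _), Complex.mul_conj, hphase,
    Complex.ofReal_one, one_mul]

end Weyl

section CentredKernel

/-- The kernel `⟪u(x + y/2), v(x - y/2)⟫` of the operator `|v⟩⟨u|` in terms of the midpoint and the
difference of its two arguments. -/
def centredKernel (u v : V → F) (x y : V) : ℂ :=
  ⟪u (x + (2⁻¹ : ℝ) • y), v (x - (2⁻¹ : ℝ) • y)⟫_ℂ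

lemma stronglyMeasurable_centredKernel (u v : Lp F 2 (volume : Measure V)) :
    StronglyMeasurable fun z : V × V => centredKernel u v z.1 z.2 :=
  ((Lp.stronglyMeasurable u).comp_measurable (by fun_prop)).inner
    ((Lp.stronglyMeasurable v).comp_measurable (by fun_prop))

lemma integrable_inner_add_add (u v : Lp F 2 (volume : Measure V)) (h k : V) :
    Integrable fun x => ⟪u (x + h), v (x + k)⟫_ℂ := by
  refine (L2.integrable_inner (𝕜 := ℂ) (mk h +ᵥ u) (mk k +ᵥ v)).congr ?_
  filter_upwards [coeFn_vadd h u, coeFn_vadd k v] with x hu hv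
  rw [hu, hv]

lemma integrable_centredKernel_left (u v : Lp F 2 (volume : Measure V)) (y : V) :
    Integrable fun x => centredKernel u v x y := by
  simpa only [centredKernel, sub_eq_add_neg] using integrable_inner_add_add u v _ _

lemma integrable_norm_sq {G : Type*} [NormedAddCommGroup G] (u : Lp G 2 (volume : Measure V)) :
    Integrable fun x => ‖u x‖ ^ 2 :=
  (memLp_two_iff_integrable_sq_norm (Lp.memLp u).1).1 (Lp.memLp u)

lemma norm_inner_le_sq_add_sq (x y : F) : ‖⟪x, y⟫_ℂ‖ ≤ ‖x‖ ^ 2 + ‖y‖ ^ 2 :=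
  (norm_inner_le_norm x y).trans (by nlinarith [sq_nonneg (‖x‖ - ‖y‖), sq_nonneg (‖x‖ + ‖y‖)])

lemma integrable_norm_sq_add_norm_sq {G : Type*} [NormedAddCommGroup G]
    (u v : Lp G 2 (volume : Measure V)) (x : V) :
    Integrable fun y => ‖u (x + (2⁻¹ : ℝ) • y)‖ ^ 2 + ‖v (x - (2⁻¹ : ℝ) • y)‖ ^ 2 :=
  ((integrable_norm_sq u).comp_add_left x |>.comp_smul (by norm_num)).add
    ((integrable_norm_sq v).comp_sub_left x |>.comp_smul (by norm_num))

lemma integrable_centredKernel_right (u v : Lp F 2 (volume : Measure V)) (x : V) :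
    Integrable fun y => centredKernel u v x y :=
  (integrable_norm_sq_add_norm_sq u v x).mono'
    ((stronglyMeasurable_centredKernel u v).comp_measurable
      (measurable_prodMk_left (x := x))).aestronglyMeasurable
    (Eventually.of_forall fun _ => norm_inner_le_sq_add_sq _ _)

lemma integral_norm_centredKernel_le (u v : Lp F 2 (volume : Measure V)) (x : V) :
    ∫ y, ‖centredKernel u v x y‖ ≤
      2 ^ Module.finrank ℝ V * ((∫ y, ‖u y‖ ^ 2) + ∫ y, ‖v y‖ ^ 2) := by
  refine (integral_mono (integrable_centredKernel_right u v x).norm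
    (integrable_norm_sq_add_norm_sq u v x) fun y => norm_inner_le_sq_add_sq _ _).trans_eq ?_
  rw [Measure.integral_comp_inv_smul volume (fun y => ‖u (x + y)‖ ^ 2 + ‖v (x - y)‖ ^ 2),
    integral_add ((integrable_norm_sq u).comp_add_left x) ((integrable_norm_sq v).comp_sub_left x),
    integral_add_left_eq_self (fun y => ‖u y‖ ^ 2) x,
    integral_sub_left_eq_self (fun y => ‖v y‖ ^ 2) volume x, smul_eq_mul,
    abs_of_pos (by positivity)]

end CentredKernel

section GaussianWeight

section

variable {E : Type*} [NormedAddCommGroup E]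

/-- The Gaussian `e^{-π‖x‖²}`, which is its own Fourier transform. -/
def gaussianWeight (x : E) : ℝ := Real.exp (-Real.pi * ‖x‖ ^ 2)

lemma gaussianWeight_nonneg (x : E) : 0 ≤ gaussianWeight x := (Real.exp_pos _).le

lemma gaussianWeight_le_one (x : E) : gaussianWeight x ≤ 1 := by
  rw [gaussianWeight, Real.exp_le_one_iff, neg_mul, neg_nonpos]
  positivity

lemma gaussianWeight_zero : gaussianWeight (0 : E) = 1 := by simp [gaussianWeight]

lemma continuous_gaussianWeight : Continuous (gaussianWeight : E → ℝ) := by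
  unfold gaussianWeight
  fun_prop

end

lemma fourier_gaussianWeight (y : V) :
    𝓕 (fun x : V => (gaussianWeight x : ℂ)) y = gaussianWeight y := by
  simp only [gaussianWeight, Complex.ofReal_exp]
  have hπ := Complex.ofReal_ne_zero.2 Real.pi_ne_zero
  convert fourier_gaussian_innerProductSpace (b := Real.pi) (V := V) (by simp [Real.pi_pos]) y
    using 1
  · simp
  · rw [div_self hπ, Complex.one_cpow, one_mul]
    congr 1
    push_cast
    field_simp

lemma integrable_gaussianWeight : Integrable (gaussianWeight : V → ℝ) := by
  refine (GaussianFourier.integrable_cexp_neg_mul_sq_norm_add (b := Real.pi)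
    (by simp [Real.pi_pos]) 0 (0 : V)).re.congr (Eventually.of_forall fun x => ?_)
  simp only [gaussianWeight, zero_mul, add_zero, RCLike.re_to_complex]
  exact_mod_cast Complex.ofReal_re _

lemma integral_gaussianWeight : ∫ x : V, gaussianWeight x = 1 := by
  simp only [gaussianWeight]
  rw [GaussianFourier.integral_rexp_neg_mul_sq_norm Real.pi_pos, div_self Real.pi_ne_zero,
    Real.one_rpow]

lemma integral_gaussianWeight_mul_fourierChar (y : V) :
    ∫ x, (gaussianWeight x : ℂ) * fourierChar ⟪x, y⟫_ℝ = gaussianWeight y := by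
  have h := fourier_gaussianWeight (-y)
  rw [Real.fourier_eq] at h
  simpa [gaussianWeight, Circle.smul_def, mul_comm] using h

end GaussianWeight

section CrossSpectrum

variable (F) in
/-- The complex inner product as a real-bilinear map. -/
def innerBilin : F →L[ℝ] F →L[ℝ] ℂ :=
  (isBoundedBilinearMap_inner (𝕜 := ℂ) (E := F)).toContinuousLinearMap

/-- The pointwise inner product as a real-bilinear map `L² × L² → L¹`. -/
def innerLp {α : Type*} [MeasurableSpace α] (μ : Measure α) :
    Lp F 2 μ →L[ℝ] Lp F 2 μ →L[ℝ] Lp ℂ 1 μ :=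
  (innerBilin F).holderL μ 2 2 1

lemma coeFn_innerLp {α : Type*} [MeasurableSpace α] {μ : Measure α} (u v : Lp F 2 μ) :
    innerLp μ u v =ᵐ[μ] fun x => ⟪u x, v x⟫_ℂ :=
  ContinuousLinearMap.coeFn_holder _ _ _

variable [CompleteSpace F]

/-- The integrable function `s ↦ ⟪(𝓕 u)(s + h), (𝓕 v)(s - h)⟫`. -/
def crossSpectrum (u v : Lp F 2 (volume : Measure V)) (h : V) : Lp ℂ 1 (volume : Measure V) :=
  innerLp volume (mk h +ᵥ 𝓕 u) (mk (-h) +ᵥ 𝓕 v)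

lemma continuous_crossSpectrum (u v : Lp F 2 (volume : Measure V)) :
    Continuous (crossSpectrum u v) := by
  have : Fact ((2 : ℝ≥0∞) ≠ ∞) := ⟨ENNReal.ofNat_ne_top⟩
  have hmk : Continuous (mk : V → Vᵈᵃᵃ) := DomAddAct.continuous_mk
  exact ((innerLp volume).continuous.comp (hmk.vadd continuous_const)).clm_apply
    ((hmk.comp continuous_neg).vadd continuous_const)

lemma norm_crossSpectrum_le (u v : Lp F 2 (volume : Measure V)) (h : V) :
    ‖crossSpectrum u v h‖ ≤ ‖innerBilin F‖ * ‖u‖ * ‖v‖ := by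
  refine ((innerBilin F).norm_holder_apply_apply_le _ _).trans_eq ?_
  rw [DomAddAct.norm_vadd_Lp, DomAddAct.norm_vadd_Lp, Lp.norm_fourier_eq, Lp.norm_fourier_eq]

lemma fourier_crossSpectrum (u v : Lp F 2 (volume : Measure V)) (h y : V) :
    𝓕 (crossSpectrum u v h : V → ℂ) y =
      ∫ x, fourierChar ⟪(2 : ℝ) • h, x⟫_ℝ • centredKernel u v x y := by
  simp only [centredKernel]
  rw [← inner_modulate_vadd, ← inner_modulate_vadd_fourier, Real.fourier_eq]
  have key := inner_modulate_vadd (-((2⁻¹ : ℝ) • y)) h (𝓕 u) (𝓕 v)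
  rw [neg_neg] at key
  rw [key]
  refine integral_congr_ae ?_
  filter_upwards [coeFn_innerLp (mk h +ᵥ 𝓕 u) (mk (-h) +ᵥ 𝓕 v), coeFn_vadd h (𝓕 u),
    coeFn_vadd (-h) (𝓕 v)] with s hs hu hv
  rw [crossSpectrum, hs, hu, hv, smul_neg, smul_inv_smul₀ two_ne_zero, inner_neg_left,
    real_inner_comm, sub_eq_add_neg]

end CrossSpectrum

section Smoothing

variable [CompleteSpace F]

/-- The Gaussian average of `crossSpectrum u v` at scale `ε`. -/
def smoothSpectrum (u v : Lp F 2 (volume : Measure V)) (ε : ℝ) : Lp ℂ 1 (volume : Measure V) :=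
  ∫ h, gaussianWeight h • crossSpectrum u v (ε • h)

lemma integrable_gaussianWeight_smul_crossSpectrum (u v : Lp F 2 (volume : Measure V)) (ε : ℝ) :
    Integrable fun h => gaussianWeight h • crossSpectrum u v (ε • h) :=
  integrable_gaussianWeight.smul_bdd (‖innerBilin F‖ * ‖u‖ * ‖v‖)
    ((continuous_crossSpectrum u v).comp (by fun_prop)).aestronglyMeasurable
    (Eventually.of_forall fun _ => norm_crossSpectrum_le u v _)

lemma tendsto_smoothSpectrum (u v : Lp F 2 (volume : Measure V)) {ε : ℕ → ℝ}
    (hε : Tendsto ε atTop (𝓝 0)) :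
    Tendsto (fun n => smoothSpectrum u v (ε n)) atTop (𝓝 (crossSpectrum u v 0)) := by
  rw [← one_smul ℝ (crossSpectrum u v 0), ← integral_gaussianWeight (V := V),
    ← integral_smul_const]
  refine tendsto_integral_of_dominated_convergence
    (fun h => gaussianWeight h * (‖innerBilin F‖ * ‖u‖ * ‖v‖))
    (fun n => (integrable_gaussianWeight_smul_crossSpectrum u v (ε n)).1)
    (integrable_gaussianWeight.mul_const _) ?_ ?_
  · refine fun n => Eventually.of_forall fun h => ?_
    rw [norm_smul, Real.norm_of_nonneg (gaussianWeight_nonneg h)]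
    exact mul_le_mul_of_nonneg_left (norm_crossSpectrum_le u v _) (gaussianWeight_nonneg h)
  · refine Eventually.of_forall fun h => Tendsto.const_smul ?_ _
    refine ((continuous_crossSpectrum u v).tendsto 0).comp ?_
    simpa using hε.smul_const h

/-- The integral over the midpoint of `centredKernel u v`, with the cutoff
`gaussianWeight (2εx)`. -/
def smoothCorrelation (u v : V → F) (ε : ℝ) (y : V) : ℂ :=
  ∫ x, (gaussianWeight ((2 * ε) • x) : ℂ) * centredKernel u v x y

lemma fourier_smoothSpectrum_eq_integral (u v : Lp F 2 (volume : Measure V)) (ε : ℝ) (y : V) :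
    𝓕 (smoothSpectrum u v ε : V → ℂ) y =
      ∫ h, gaussianWeight h • 𝓕 (crossSpectrum u v (ε • h) : V → ℂ) y := by
  let T : Lp ℂ 1 (volume : Measure V) →L[ℂ] ℂ :=
    (BoundedContinuousFunction.evalCLM ℂ y).comp (Real.Lp.fourierTransformCLM V ℂ)
  have hT : ∀ f : Lp ℂ 1 (volume : Measure V), T f = 𝓕 (f : V → ℂ) y := fun _ => rfl
  simp only [← hT, smoothSpectrum,
    ← T.integral_comp_comm (integrable_gaussianWeight_smul_crossSpectrum u v ε),
    T.map_smul_of_tower]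

lemma fourier_smoothSpectrum (u v : Lp F 2 (volume : Measure V)) (ε : ℝ) :
    𝓕 (smoothSpectrum u v ε : V → ℂ) = smoothCorrelation u v ε := by
  ext y
  have hswap : Integrable (fun z : V × V => (gaussianWeight z.1 : ℂ) *
      fourierChar ⟪z.1, (2 * ε) • z.2⟫_ℝ * centredKernel u v z.2 y) (volume.prod volume) := by
    refine (((integrable_gaussianWeight.ofReal (𝕜 := ℂ)).mul_prod
      (integrable_centredKernel_left u v y)).bdd_mul (c := 1)
      (f := fun z : V × V => (fourierChar ⟪z.1, (2 * ε) • z.2⟫_ℝ : ℂ)) ?_ ?_).congr ?_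
    · exact (by fun_prop : Continuous fun z : V × V =>
        (fourierChar ⟪z.1, (2 * ε) • z.2⟫_ℝ : ℂ)).aestronglyMeasurable
    · exact Eventually.of_forall fun z => (Circle.norm_coe _).le
    · exact Eventually.of_forall fun z => (mul_assoc _ _ _).trans (mul_left_comm _ _ _) |>.symm
  calc 𝓕 (smoothSpectrum u v ε : V → ℂ) y
      = ∫ h, ∫ x, (gaussianWeight h : ℂ) * fourierChar ⟪h, (2 * ε) • x⟫_ℝ *
          centredKernel u v x y := by
        simp only [fourier_smoothSpectrum_eq_integral, fourier_crossSpectrum, mul_assoc,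
          integral_const_mul, Complex.real_smul, Circle.smul_def, smul_eq_mul, smul_smul,
          real_inner_smul_left, real_inner_smul_right]
    _ = ∫ x, ∫ h, (gaussianWeight h : ℂ) * fourierChar ⟪h, (2 * ε) • x⟫_ℝ *
          centredKernel u v x y := integral_integral_swap hswap
    _ = smoothCorrelation u v ε y := by
        simp only [integral_mul_const, integral_gaussianWeight_mul_fourierChar, smoothCorrelation]

end Smoothing

section CrossWigner

/-- The cross-Wigner function of two square-integrable functions, with the frequency normalised as
in the Fourier transform `𝓕`. -/
def crossWigner (u v : V → F) (x s : V) : ℂ := 𝓕⁻ (centredKernel u v x) s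

lemma integrable_gaussianWeight_mul_centredKernel (u v : Lp F 2 (volume : Measure V)) {ε : ℝ}
    (hε : ε ≠ 0) :
    Integrable (fun z : V × V => (gaussianWeight ((2 * ε) • z.1) : ℂ) *
      centredKernel u v z.1 z.2) (volume.prod volume) := by
  have hg : Continuous fun x : V => (gaussianWeight ((2 * ε) • x) : ℂ) :=
    Complex.continuous_ofReal.comp (continuous_gaussianWeight.comp (by fun_prop))
  have hm : StronglyMeasurable (fun z : V × V => (gaussianWeight ((2 * ε) • z.1) : ℂ) *
      centredKernel u v z.1 z.2) :=
    (hg.comp continuous_fst).stronglyMeasurable.mul (stronglyMeasurable_centredKernel u v)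
  have hgi : Integrable fun x : V => gaussianWeight ((2 * ε) • x) :=
    integrable_gaussianWeight.comp_smul (mul_ne_zero two_ne_zero hε)
  refine (integrable_prod_iff hm.aestronglyMeasurable).2 ⟨Eventually.of_forall fun x =>
    (integrable_centredKernel_right u v x).const_mul (gaussianWeight ((2 * ε) • x) : ℂ),
    (hgi.mul_const (2 ^ Module.finrank ℝ V * ((∫ y, ‖u y‖ ^ 2) + ∫ y, ‖v y‖ ^ 2))).mono'
      hm.norm.integral_prod_right'.aestronglyMeasurable (Eventually.of_forall fun x => ?_)⟩
  rw [Real.norm_of_nonneg (integral_nonneg fun _ => norm_nonneg _)]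
  simp only [norm_mul, Complex.norm_real, Real.norm_of_nonneg (gaussianWeight_nonneg _)]
  rw [integral_const_mul]
  exact mul_le_mul_of_nonneg_left (integral_norm_centredKernel_le u v x) (gaussianWeight_nonneg _)

lemma integrable_smoothCorrelation (u v : Lp F 2 (volume : Measure V)) {ε : ℝ} (hε : ε ≠ 0) :
    Integrable (smoothCorrelation u v ε) :=
  (integrable_gaussianWeight_mul_centredKernel u v hε).integral_prod_right

lemma fourierInv_smoothCorrelation (u v : Lp F 2 (volume : Measure V)) {ε : ℝ} (hε : ε ≠ 0)
    (s : V) :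
    𝓕⁻ (smoothCorrelation u v ε) s =
      ∫ x, (gaussianWeight ((2 * ε) • x) : ℂ) * crossWigner u v x s := by
  have hswap : Integrable (fun z : V × V => (fourierChar ⟪z.2, s⟫_ℝ : ℂ) *
      ((gaussianWeight ((2 * ε) • z.1) : ℂ) * centredKernel u v z.1 z.2))
      (volume.prod volume) := by
    refine (integrable_gaussianWeight_mul_centredKernel u v hε).bdd_mul (c := 1)
      (f := fun z : V × V => (fourierChar ⟪z.2, s⟫_ℝ : ℂ)) ?_ ?_
    · exact (by fun_prop : Continuous fun z : V × V =>
        (fourierChar ⟪z.2, s⟫_ℝ : ℂ)).aestronglyMeasurable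
    · exact Eventually.of_forall fun z => (Circle.norm_coe _).le
  calc 𝓕⁻ (smoothCorrelation u v ε) s
      = ∫ y, ∫ x, (fourierChar ⟪y, s⟫_ℝ : ℂ) *
          ((gaussianWeight ((2 * ε) • x) : ℂ) * centredKernel u v x y) := by
        simp only [Real.fourierInv_eq, integral_const_mul, Circle.smul_def, smul_eq_mul,
          smoothCorrelation]
    _ = ∫ x, ∫ y, (fourierChar ⟪y, s⟫_ℝ : ℂ) *
          ((gaussianWeight ((2 * ε) • x) : ℂ) * centredKernel u v x y) :=
        (integral_integral_swap hswap).symm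
    _ = ∫ x, (gaussianWeight ((2 * ε) • x) : ℂ) * crossWigner u v x s := by
        simp only [crossWigner, Real.fourierInv_eq, ← integral_const_mul, Circle.smul_def,
          smul_eq_mul, mul_left_comm]

variable [CompleteSpace F]

lemma smoothSpectrum_ae_eq (u v : Lp F 2 (volume : Measure V)) {ε : ℝ} (hε : ε ≠ 0) :
    smoothSpectrum u v ε =ᵐ[volume]
      fun s => ∫ x, (gaussianWeight ((2 * ε) • x) : ℂ) * crossWigner u v x s := by
  have hinv := fourierInv_fourier_ae_eq (L1.integrable_coeFn (smoothSpectrum u v ε))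
    ((fourier_smoothSpectrum u v ε).symm ▸ integrable_smoothCorrelation u v hε)
  filter_upwards [hinv] with s hs
  rw [hs, fourier_smoothSpectrum, fourierInv_smoothCorrelation u v hε]

lemma tendsto_integral_gaussianWeight_smul_mul {ε : ℕ → ℝ} (hε : Tendsto ε atTop (𝓝 0))
    {f : V → ℂ} (hf : Integrable f) :
    Tendsto (fun n => ∫ x, (gaussianWeight (ε n • x) : ℂ) * f x) atTop (𝓝 (∫ x, f x)) := by
  have hcont : Continuous fun x : V => (gaussianWeight x : ℂ) :=
    Complex.continuous_ofReal.comp continuous_gaussianWeight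
  refine tendsto_integral_of_dominated_convergence (fun x => ‖f x‖)
    (fun n => (hcont.comp (by fun_prop)).aestronglyMeasurable.mul hf.1) hf.norm
    (fun n => Eventually.of_forall fun x => ?_) (Eventually.of_forall fun x => ?_)
  · rw [norm_mul, Complex.norm_real, Real.norm_of_nonneg (gaussianWeight_nonneg _)]
    exact mul_le_of_le_one_left (norm_nonneg _) (gaussianWeight_le_one _)
  · have h := (hcont.tendsto 0).comp (by simpa using hε.smul_const x)
    simpa [gaussianWeight_zero] using h.mul_const (f x)

/- Without joint integrability the two integrations cannot be exchanged; a Gaussian cutoff in `x`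
makes Fourier inversion available, and is removed along an almost everywhere convergent
subsequence. -/
lemma integral_crossWigner_ae_eq (u v : Lp F 2 (volume : Measure V))
    (hW : ∀ᵐ s, Integrable fun x => crossWigner u v x s) :
    (fun s => ∫ x, crossWigner u v x s) =ᵐ[volume] crossSpectrum u v 0 := by
  let ε : ℕ → ℝ := fun n => 1 / ((n : ℝ) + 1)
  have hε : Tendsto ε atTop (𝓝 0) := tendsto_one_div_add_atTop_nhds_zero_nat
  obtain ⟨ns, hns, hlim⟩ := (tendstoInMeasure_of_tendsto_Lp
    (tendsto_smoothSpectrum u v hε)).exists_seq_tendsto_ae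
  have hsmooth : ∀ᵐ s, ∀ n, smoothSpectrum u v (ε n) s =
      ∫ x, (gaussianWeight ((2 * ε n) • x) : ℂ) * crossWigner u v x s :=
    ae_all_iff.2 fun n => smoothSpectrum_ae_eq u v Nat.one_div_pos_of_nat.ne'
  filter_upwards [hlim, hsmooth, hW] with s hs hsm hint
  have hscale : Tendsto (fun n => 2 * ε (ns n)) atTop (𝓝 0) := by
    simpa using (hε.comp hns.tendsto_atTop).const_mul 2
  refine tendsto_nhds_unique (tendsto_integral_gaussianWeight_smul_mul hscale hint) ?_
  simpa only [hsm] using hs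

lemma fourier_integral_crossWigner (u v : Lp F 2 (volume : Measure V))
    (hW : ∀ᵐ s, Integrable fun x => crossWigner u v x s) (y : V) :
    𝓕 (fun s => ∫ x, crossWigner u v x s) y = ∫ x, centredKernel u v x y := by
  rw [Real.fourier_congr_ae (integral_crossWigner_ae_eq u v hW), fourier_crossSpectrum]
  simp

end CrossWigner

section GramKernel

/-! ### Wigner functions of operator kernels -/

/-- `K` is the integral kernel of the operator `∑ₙ |vₙ⟩⟨uₙ|`, where `uₙ`, `vₙ` are the components of
the vector-valued functions `u`, `v`. The equality holds outside a product of null sets, so that it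
can be restricted to shifted diagonals, which are null sets of the plane. -/
def IsGramKernel (K : V → V → ℂ) (u v : V → F) : Prop :=
  ∀ᶠ z in ae (volume : Measure V) ×ˢ ae (volume : Measure V), K z.1 z.2 = ⟪u z.2, v z.1⟫_ℂ

/-- The Wigner transform of an operator kernel, with the frequency normalised as in the Fourier
transform `𝓕`. -/
def wignerTransform (K : V → V → ℂ) (x s : V) : ℂ :=
  𝓕⁻ (fun y => K (x - (2⁻¹ : ℝ) • y) (x + (2⁻¹ : ℝ) • y)) s

lemma wignerTransform_midpoint_mul (K : V → V → ℂ) (g : V → ℂ) (x s : V) :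
    wignerTransform (fun x y => g (midpoint ℝ x y) * K x y) x s = g x * wignerTransform K x s := by
  simp only [wignerTransform, Real.fourierInv_eq, midpoint_sub_add, ← integral_const_mul,
    Circle.smul_def, smul_eq_mul, mul_left_comm]

lemma tendsto_add_right_ae (h : V) :
    Tendsto (fun x : V => x + h) (ae volume) (ae volume) :=
  (measurePreserving_add_right volume h).quasiMeasurePreserving.tendsto_ae

lemma tendsto_add_smul_ae (x : V) {c : ℝ} (hc : c ≠ 0) :
    Tendsto (fun y : V => x + c • y) (ae volume) (ae volume) :=
  ((measurePreserving_add_left volume x).quasiMeasurePreserving.comp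
    (Measure.quasiMeasurePreserving_smul volume hc)).tendsto_ae

namespace IsGramKernel

variable {K K' : V → V → ℂ}

section Algebra

variable {u u' v v' : V → F}

lemma congr (hK : IsGramKernel K u v) (hu : u =ᵐ[volume] u') (hv : v =ᵐ[volume] v') :
    IsGramKernel K u' v' := by
  filter_upwards [hK, hv.prod_mk hu] with z hz h
  rw [hz, h.1, h.2]

lemma mul_left (hK : IsGramKernel K u v) {c : V → ℂ} (hv : v' =ᵐ[volume] fun x => c x • v x) :
    IsGramKernel (fun x y => c x * K x y) u v' := by
  filter_upwards [hK, hv.prod_inl _] with z hz h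
  rw [hz, h, inner_smul_right]

lemma mul_right (hK : IsGramKernel K u v) {c : V → ℂ} (hu : u' =ᵐ[volume] fun x => c x • u x) :
    IsGramKernel (fun x y => conj (c y) * K x y) u' v := by
  filter_upwards [hK, hu.prod_inr _] with z hz h
  rw [hz, h, inner_smul_left]

end Algebra

lemma exists_add {u v u' v' : Lp F 2 (volume : Measure V)} (hK : IsGramKernel K u v)
    (hK' : IsGramKernel K' u' v') :
    ∃ a b : Lp (WithLp 2 (F × F)) 2 (volume : Measure V),
      IsGramKernel (fun x y => K x y + K' x y) a b := by
  have hpair : ∀ f g : Lp F 2 (volume : Measure V),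
      MemLp (fun x => WithLp.toLp 2 (f x, g x)) 2 volume := fun f g =>
    memLp_prodLp_iff.2 ⟨Lp.memLp f, Lp.memLp g⟩
  refine ⟨(hpair u u').toLp, (hpair v v').toLp,
    IsGramKernel.congr ?_ (hpair u u').coeFn_toLp.symm (hpair v v').coeFn_toLp.symm⟩
  filter_upwards [hK, hK'] with z hz hz'
  rw [hz, hz', WithLp.prod_inner_apply]

variable {u v : Lp F 2 (volume : Measure V)}

lemma integrable_add_add (hK : IsGramKernel K u v) (h k : V) :
    Integrable fun x => K (x + h) (x + k) :=
  (integrable_inner_add_add u v k h).congr <| EventuallyEq.symm <|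
    ((tendsto_add_right_ae h).prodMk (tendsto_add_right_ae k)).eventually hK

lemma ae_eq_centredKernel (hK : IsGramKernel K u v) (y : V) :
    (fun x => K (x - (2⁻¹ : ℝ) • y) (x + (2⁻¹ : ℝ) • y)) =ᵐ[volume]
      fun x => centredKernel u v x y := by
  simpa only [sub_eq_add_neg, centredKernel, EventuallyEq] using
    ((tendsto_add_right_ae (-((2⁻¹ : ℝ) • y))).prodMk
      (tendsto_add_right_ae ((2⁻¹ : ℝ) • y))).eventually hK

lemma wignerTransform_eq_crossWigner (hK : IsGramKernel K u v) :
    wignerTransform K = crossWigner u v := by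
  ext x s
  refine Real.fourierInv_congr_ae ?_ s
  simpa only [sub_eq_add_neg, neg_smul, centredKernel, EventuallyEq] using
    ((tendsto_add_smul_ae x (c := -2⁻¹) (by norm_num)).prodMk
      (tendsto_add_smul_ae x (c := 2⁻¹) (by norm_num))).eventually hK

variable [CompleteSpace F]

lemma integrable_integral_wignerTransform (hK : IsGramKernel K u v)
    (hW : ∀ᵐ s, Integrable fun x => wignerTransform K x s) :
    Integrable fun s => ∫ x, wignerTransform K x s := by
  rw [hK.wignerTransform_eq_crossWigner] at hW ⊢
  exact (L1.integrable_coeFn (crossSpectrum u v 0)).congr (integral_crossWigner_ae_eq u v hW).symm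

lemma fourier_integral_wignerTransform (hK : IsGramKernel K u v)
    (hW : ∀ᵐ s, Integrable fun x => wignerTransform K x s) (y : V) :
    𝓕 (fun s => ∫ x, wignerTransform K x s) y =
      ∫ x, K (x - (2⁻¹ : ℝ) • y) (x + (2⁻¹ : ℝ) • y) := by
  rw [integral_congr_ae (hK.ae_eq_centredKernel y)]
  rw [hK.wignerTransform_eq_crossWigner] at hW ⊢
  exact fourier_integral_crossWigner u v hW y

end IsGramKernel

lemma norm_crossWigner_le (u v : Lp F 2 (volume : Measure V)) (x s : V) :
    ‖crossWigner u v x s‖ ≤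
      2 ^ Module.finrank ℝ V * ((∫ y, ‖u y‖ ^ 2) + ∫ y, ‖v y‖ ^ 2) := by
  rw [crossWigner, Real.fourierInv_eq]
  refine (norm_integral_le_integral_norm _).trans ?_
  simpa only [Circle.norm_smul] using integral_norm_centredKernel_le u v x

lemma stronglyMeasurable_crossWigner (u v : Lp F 2 (volume : Measure V)) (s : V) :
    StronglyMeasurable fun x => crossWigner u v x s := by
  have hf : Continuous fun z : V × V => (fourierChar ⟪z.2, s⟫_ℝ : ℂ) := by fun_prop
  simp only [crossWigner, Real.fourierInv_eq]
  exact (hf.stronglyMeasurable.smul (stronglyMeasurable_centredKernel u v)).integral_prod_right'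

lemma integrable_of_bounded_of_integrable_norm_smul {G : Type*} [NormedAddCommGroup G]
    [NormedSpace ℝ G] {f : V → G} (hf : AEStronglyMeasurable f volume) {C : ℝ}
    (hC : ∀ x, ‖f x‖ ≤ C) (h : Integrable fun x => ‖x‖ • f x) : Integrable f := by
  have hball : IntegrableOn f (Metric.closedBall 0 1) :=
    Measure.integrableOn_of_bounded measure_closedBall_lt_top.ne hf
      (Eventually.of_forall hC)
  have hcompl : IntegrableOn f (Metric.closedBall 0 1)ᶜ := by
    refine Integrable.mono h.integrableOn hf.restrict
      ((ae_restrict_iff' measurableSet_closedBall.compl).2 (Eventually.of_forall fun x hx => ?_))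
    have hx' : 1 ≤ ‖x‖ := by simpa using (not_le.1 (mt mem_closedBall_zero_iff.2 hx)).le
    rw [norm_smul, norm_norm]
    exact le_mul_of_one_le_left (norm_nonneg _) hx'
  exact integrableOn_univ.1 (Set.union_compl_self (Metric.closedBall (0 : V) 1) ▸
    hball.union hcompl)

end GramKernel

section SequenceValued

/-! ### Square-summable sequences of square-integrable functions -/

variable {α G : Type*} [NormedAddCommGroup G] {f : ℕ → α → G}

open Classical in
/-- A sequence of functions as one function with values in `ℓ²(ℕ)`, with value `0` at the points
where the sequence is not square-summable. -/
def sequenceValued (f : ℕ → α → G) (x : α) : lp (fun _ : ℕ => G) 2 :=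
  if h : Memℓp (fun n => f n x) 2 then ⟨fun n => f n x, h⟩ else 0

lemma sequenceValued_apply {x : α} (h : Memℓp (fun n => f n x) 2) (n : ℕ) :
    sequenceValued f x n = f n x := by
  rw [sequenceValued, dif_pos h]

lemma norm_sequenceValued_sq {x : α} (h : Memℓp (fun n => f n x) 2) :
    ‖sequenceValued f x‖ ^ 2 = (∑' n, ENNReal.ofReal (‖f n x‖ ^ 2)).toReal := by
  have hnorm := lp.norm_rpow_eq_tsum (p := 2) (by norm_num) (sequenceValued f x)
  simp only [ENNReal.toReal_ofNat, Real.rpow_ofNat, sequenceValued_apply h] at hnorm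
  rw [hnorm, ENNReal.tsum_toReal_eq fun n => ENNReal.ofReal_ne_top]
  simp only [ENNReal.toReal_ofReal (sq_nonneg _)]

variable [MeasurableSpace α] {μ : Measure α}

lemma lintegral_tsum_norm_sq_ne_top (hf : ∀ n, MemLp (f n) 2 μ)
    (hsum : Summable fun n => ∫ x, ‖f n x‖ ^ 2 ∂μ) :
    ∫⁻ x, ∑' n, ENNReal.ofReal (‖f n x‖ ^ 2) ∂μ ≠ ∞ := by
  have hint : ∀ n, Integrable (fun x => ‖f n x‖ ^ 2) μ := fun n =>
    (memLp_two_iff_integrable_sq_norm (hf n).1).1 (hf n)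
  rw [lintegral_tsum fun n => (hint n).1.aemeasurable.ennreal_ofReal]
  simp only [← ofReal_integral_eq_lintegral_ofReal (hint _)
    (Eventually.of_forall fun _ => sq_nonneg _)]
  exact hsum.tsum_ofReal_ne_top

lemma aemeasurable_tsum_norm_sq (hf : ∀ n, MemLp (f n) 2 μ) :
    AEMeasurable (fun x => ∑' n, ENNReal.ofReal (‖f n x‖ ^ 2)) μ :=
  AEMeasurable.tsum fun n => ((hf n).1.norm.aemeasurable.pow_const 2).ennreal_ofReal

lemma ae_memℓp_two (hf : ∀ n, MemLp (f n) 2 μ) (hsum : Summable fun n => ∫ x, ‖f n x‖ ^ 2 ∂μ) :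
    ∀ᵐ x ∂μ, Memℓp (fun n => f n x) 2 := by
  filter_upwards [ae_lt_top' (aemeasurable_tsum_norm_sq hf)
    (lintegral_tsum_norm_sq_ne_top hf hsum)] with x hx
  refine (memℓp_gen_iff (by norm_num)).2 ?_
  simpa [ENNReal.toReal_ofReal] using ENNReal.summable_toReal hx.ne

lemma memLp_sequenceValued (hf : ∀ n, MemLp (f n) 2 μ)
    (hsum : Summable fun n => ∫ x, ‖f n x‖ ^ 2 ∂μ) : MemLp (sequenceValued f) 2 μ := by
  have hmem := ae_memℓp_two hf hsum
  have hmeas : AEStronglyMeasurable (sequenceValued f) μ := by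
    refine aestronglyMeasurable_of_tendsto_ae atTop
      (f := fun (N : ℕ) x => ∑ n ∈ Finset.range N, lp.single 2 n (f n x)) (fun N => ?_) ?_
    · exact Finset.aestronglyMeasurable_fun_sum _ fun n _ =>
        (lp.isometry_single (E := fun _ : ℕ => G) (p := 2) n).continuous.comp_aestronglyMeasurable
          (hf n).1
    · filter_upwards [hmem] with x hx
      have h := lp.hasSum_single (p := 2) (by norm_num) (sequenceValued f x)
      simp only [sequenceValued_apply hx] at h
      exact h.tendsto_sum_nat
  rw [memLp_two_iff_integrable_sq_norm hmeas]
  refine (integrable_toReal_of_lintegral_ne_top (aemeasurable_tsum_norm_sq hf)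
    (lintegral_tsum_norm_sq_ne_top hf hsum)).congr ?_
  filter_upwards [hmem] with x hx
  rw [norm_sequenceValued_sq hx]

end SequenceValued

namespace WeightState

/-! ### Purification and moments of a state of the weight -/

/-- The auxiliary Hilbert space `ℓ²(ℕ)` of a purification of the state of the weight. -/
abbrev AuxSpace := lp (fun _ : ℕ => ℂ) 2

/-- The components `√qₙ φₙ` of the purified wave function. -/
def amplitude (ρW : WeightState) (n : ℕ) (E : ℝ) : ℂ :=
  (Real.sqrt (ρW.prob n) : ℂ) * ρW.wave n E

variable {ρW : WeightState}

lemma memLp_amplitude (n : ℕ) : MemLp (ρW.amplitude n) 2 volume :=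
  (ρW.memLp_wave n).const_mul _

lemma integral_norm_amplitude_sq (n : ℕ) : ∫ E, ‖ρW.amplitude n E‖ ^ 2 = ρW.prob n := by
  simp only [amplitude, norm_mul, mul_pow, Complex.norm_real, Real.norm_eq_abs, sq_abs,
    Real.sq_sqrt (ρW.prob_nonneg n)]
  rw [integral_const_mul, ρW.norm_wave, mul_one]

lemma summable_integral_norm_amplitude_sq : Summable fun n => ∫ E, ‖ρW.amplitude n E‖ ^ 2 := by
  simpa only [integral_norm_amplitude_sq] using ρW.hasSum_prob.summable

lemma kernel_eq_inner {x y : ℝ} (hx : Memℓp (fun n => ρW.amplitude n x) 2)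
    (hy : Memℓp (fun n => ρW.amplitude n y) 2) :
    ρW.kernel x y = ⟪sequenceValued ρW.amplitude y, sequenceValued ρW.amplitude x⟫_ℂ := by
  rw [lp.inner_eq_tsum, kernel]
  congr 1 with n
  have hsqrt : ((Real.sqrt (ρW.prob n) : ℝ) : ℂ) * (Real.sqrt (ρW.prob n) : ℝ) = ρW.prob n := by
    rw [← Complex.ofReal_mul, Real.mul_self_sqrt (ρW.prob_nonneg n)]
  rw [sequenceValued_apply hx, sequenceValued_apply hy, amplitude, amplitude, RCLike.inner_apply,
    map_mul, Complex.conj_ofReal, ← hsqrt, ← starRingEnd_apply]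
  ring

lemma memLp_energy_smul_sequenceValued (hmoment : FiniteSecondMoment ρW.energyDensity) :
    MemLp (fun E : ℝ => (E : ℂ) • sequenceValued ρW.amplitude E) 2 volume := by
  have hmeas : AEStronglyMeasurable
      (fun E : ℝ => (E : ℂ) • sequenceValued ρW.amplitude E) volume :=
    Complex.continuous_ofReal.aestronglyMeasurable.smul
      (memLp_sequenceValued memLp_amplitude summable_integral_norm_amplitude_sq).1
  rw [memLp_two_iff_integrable_sq_norm hmeas]
  refine Integrable.congr hmoment ?_
  filter_upwards [ae_memℓp_two memLp_amplitude summable_integral_norm_amplitude_sq] with E hE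
  rw [energyDensity, kernel_eq_inner hE hE, inner_self_eq_norm_sq_to_K, norm_smul, mul_pow,
    Complex.norm_real, Real.norm_eq_abs, sq_abs]
  norm_cast

/- Finite energy variance says that the purified wave function `a` lies in the domain of `H_W`. -/
lemma exists_isGramKernel_kernel (hmoment : FiniteSecondMoment ρW.energyDensity) :
    ∃ a b : Lp AuxSpace 2 (volume : Measure ℝ),
      IsGramKernel ρW.kernel a a ∧ b =ᵐ[volume] fun E => (E : ℂ) • a E := by
  have ha := memLp_sequenceValued (memLp_amplitude (ρW := ρW)) summable_integral_norm_amplitude_sq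
  have hb := memLp_energy_smul_sequenceValued hmoment
  have hmem := ae_memℓp_two (memLp_amplitude (ρW := ρW)) summable_integral_norm_amplitude_sq
  refine ⟨ha.toLp, hb.toLp, IsGramKernel.congr ?_ ha.coeFn_toLp.symm ha.coeFn_toLp.symm, ?_⟩
  · filter_upwards [hmem.prod_mk hmem] with z hz using kernel_eq_inner hz.1 hz.2
  · filter_upwards [ha.coeFn_toLp, hb.coeFn_toLp] with E hE hE'
    rw [hE, hE']

lemma integrable_pow_mul_kernel (hmoment : FiniteSecondMoment ρW.energyDensity) {m : ℕ}
    (hm : m ≤ 2) (h k : ℝ) :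
    Integrable fun E : ℝ => (E : ℂ) ^ m * ρW.kernel (E + h) (E + k) := by
  obtain ⟨a, b, ha, hb⟩ := exists_isGramKernel_kernel hmoment
  have i00 := ha.integrable_add_add h k
  have i10 := (ha.mul_left hb).integrable_add_add h k
  have i01 := (ha.mul_right hb).integrable_add_add h k
  have i11 := ((ha.mul_left hb).mul_right hb).integrable_add_add h k
  interval_cases m
  · simpa only [pow_zero, one_mul] using i00
  · refine (i10.sub (i00.const_mul (h : ℂ))).congr (Eventually.of_forall fun E => ?_)
    simp only [Pi.sub_apply, Complex.ofReal_add]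
    ring
  · refine ((i11.sub (i10.const_mul (k : ℂ))).sub ((i01.const_mul (h : ℂ)).sub
      (i00.const_mul (h * k : ℂ)))).congr (Eventually.of_forall fun E => ?_)
    simp only [Pi.sub_apply, Complex.conj_ofReal]
    push_cast
    ring

lemma star_kernel (x y : ℝ) : star (ρW.kernel x y) = ρW.kernel y x := by
  rw [kernel, kernel, tsum_star]
  congr 1 with n
  simp only [star_mul', star_star]
  rw [Complex.star_def, Complex.conj_ofReal]
  ring

/-- The moment `∫ xᵐ ⟨x - y/2| ρ_W |x + y/2⟩ dx` of the coherences of the weight between energies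
which differ by `y`. -/
def coherenceMoment (ρW : WeightState) (m : ℕ) (y : ℝ) : ℂ :=
  ∫ x : ℝ, (x : ℂ) ^ m * ρW.kernel (x - y / 2) (x + y / 2)

lemma coherenceMoment_neg (m : ℕ) (y : ℝ) :
    ρW.coherenceMoment m (-y) = star (ρW.coherenceMoment m y) := by
  rw [coherenceMoment, coherenceMoment, Complex.star_def, ← integral_conj]
  simp only [map_mul, map_pow, Complex.conj_ofReal, ← Complex.star_def, star_kernel, neg_div,
    sub_neg_eq_add, ← sub_eq_add_neg]

lemma coherenceMoment_one_zero (hmean : mean ρW.energyDensity = 0) :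
    ρW.coherenceMoment 1 0 = 0 := by
  have hreal : ∀ E : ℝ, (E : ℂ) * ρW.kernel E E = ((E * ρW.energyDensity E : ℝ) : ℂ) := by
    intro E
    rw [energyDensity, Complex.ofReal_mul, Complex.conj_eq_iff_re.1 (star_kernel (ρW := ρW) E E)]
  simp only [coherenceMoment, zero_div, sub_zero, add_zero, pow_one, hreal]
  rw [integral_complex_ofReal]
  exact congrArg _ hmean

/-! ### Wigner integrals -/

lemma two_pi_mul_wigner (E s : ℝ) :
    (2 * Real.pi : ℂ) * ρW.wigner E (2 * Real.pi * s) = wignerTransform ρW.kernel E s := by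
  have hpi : (2 * Real.pi : ℂ) ≠ 0 := by simp [Real.pi_ne_zero]
  rw [wigner, ← mul_assoc, mul_one_div_cancel hpi, one_mul, wignerTransform, Real.fourierInv_eq]
  congr 1 with ν
  rw [Circle.smul_def, Real.fourierChar_apply, smul_eq_mul, RCLike.inner_apply, conj_trivial,
    smul_eq_mul, div_eq_inv_mul]
  congr 2
  push_cast
  ring

lemma two_pi_mul_mul_wigner (g : ℝ → ℂ) (E s : ℝ) :
    (2 * Real.pi : ℂ) * (g E * ρW.wigner E (2 * Real.pi * s)) =
      wignerTransform (fun x y => g (midpoint ℝ x y) * ρW.kernel x y) E s := by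
  rw [wignerTransform_midpoint_mul, ← two_pi_mul_wigner, mul_left_comm]

lemma integral_exp_mul_eq_fourier (ω : ℝ) (f : ℝ → ℂ) :
    ∫ t : ℝ, Complex.exp (Complex.I * ω * t) * f t =
      𝓕 (fun s : ℝ => (2 * Real.pi : ℂ) * f (2 * Real.pi * s)) (-ω) := by
  have hscale := Measure.integral_comp_mul_left
    (fun t : ℝ => Complex.exp (Complex.I * ω * t) * f t) (2 * Real.pi)
  rw [abs_of_pos (by positivity), eq_inv_smul_iff₀ (by positivity), ← integral_smul] at hscale
  rw [← hscale, Real.fourier_eq]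
  congr 1 with s
  rw [Circle.smul_def, Real.fourierChar_apply, Complex.real_smul, smul_eq_mul, RCLike.inner_apply,
    conj_trivial, mul_left_comm]
  push_cast
  ring_nf

section Transform

variable {F : Type*} [NormedAddCommGroup F] [InnerProductSpace ℂ F] [CompleteSpace F]
  {g : ℝ → ℂ} {u v : Lp F 2 (volume : Measure ℝ)}

lemma ae_integrable_wignerTransform (hW : ∀ᵐ t : ℝ, Integrable fun E => g E * ρW.wigner E t) :
    ∀ᵐ s : ℝ, Integrable fun E =>
      wignerTransform (fun x y => g (midpoint ℝ x y) * ρW.kernel x y) E s := by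
  filter_upwards [(Measure.quasiMeasurePreserving_smul (volume : Measure ℝ)
    Real.two_pi_pos.ne').ae hW] with s hs
  simpa only [← two_pi_mul_mul_wigner, smul_eq_mul] using hs.const_mul _

lemma integrable_integral_mul_wigner
    (hK : IsGramKernel (fun x y => g (midpoint ℝ x y) * ρW.kernel x y) u v)
    (hW : ∀ᵐ t : ℝ, Integrable fun E => g E * ρW.wigner E t) :
    Integrable fun t => ∫ E, g E * ρW.wigner E t := by
  have h := hK.integrable_integral_wignerTransform (ae_integrable_wignerTransform hW)
  simp only [← two_pi_mul_mul_wigner, integral_const_mul] at h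
  rw [integrable_const_mul_iff (by simp [Real.pi_ne_zero])] at h
  exact (integrable_comp_mul_left_iff (fun t => ∫ E, g E * ρW.wigner E t)
    Real.two_pi_pos.ne').1 h

lemma integral_exp_mul_integral_mul_wigner
    (hK : IsGramKernel (fun x y => g (midpoint ℝ x y) * ρW.kernel x y) u v)
    (hW : ∀ᵐ t : ℝ, Integrable fun E => g E * ρW.wigner E t) (ω : ℝ) :
    ∫ t : ℝ, Complex.exp (Complex.I * ω * t) * ∫ E, g E * ρW.wigner E t =
      ∫ x, g x * ρW.kernel (x - -ω / 2) (x + -ω / 2) := by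
  have h := hK.fourier_integral_wignerTransform (ae_integrable_wignerTransform hW) (-ω)
  simp only [midpoint_sub_add, ← two_pi_mul_mul_wigner, integral_const_mul, smul_eq_mul,
    ← div_eq_inv_mul] at h
  rw [integral_exp_mul_eq_fourier, h]

end Transform

lemma integrable_wigner (hmoment : FiniteSecondMoment ρW.energyDensity) {t : ℝ}
    (h : Integrable fun E : ℝ => (E : ℂ) * ρW.wigner E t) :
    Integrable fun E => ρW.wigner E t := by
  obtain ⟨a, -, ha, -⟩ := exists_isGramKernel_kernel hmoment
  obtain ⟨s, rfl⟩ : ∃ s, t = 2 * Real.pi * s := ⟨t / (2 * Real.pi), by field_simp⟩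
  have hW : ∀ E, (2 * Real.pi : ℂ) * ρW.wigner E (2 * Real.pi * s) = crossWigner a a E s :=
    fun E => by rw [two_pi_mul_wigner, ha.wignerTransform_eq_crossWigner]
  have hint : Integrable fun E => crossWigner a a E s := by
    refine integrable_of_bounded_of_integrable_norm_smul
      (stronglyMeasurable_crossWigner a a s).aestronglyMeasurable
      (fun E => norm_crossWigner_le a a E s) ?_
    refine (h.const_mul (2 * Real.pi : ℂ)).mono ?_ (Eventually.of_forall fun E => ?_)
    · exact continuous_norm.aestronglyMeasurable.smul
        (stronglyMeasurable_crossWigner a a s).aestronglyMeasurable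
    · rw [mul_left_comm, hW, norm_smul, norm_mul, norm_norm, Complex.norm_real]
  simp only [← hW] at hint
  exact (integrable_const_mul_iff (by simp [Real.pi_ne_zero]) _).1 hint

/- Only `E W(E, t)` is assumed to be integrable, which is why the two Gram kernels are combined into
one before the Fourier transform is inverted. -/
lemma exists_isGramKernel_midpoint_mul_kernel (hmoment : FiniteSecondMoment ρW.energyDensity) :
    ∃ u v : Lp (WithLp 2 (AuxSpace × AuxSpace)) 2 (volume : Measure ℝ),
      IsGramKernel (fun x y => ((midpoint ℝ x y : ℝ) : ℂ) * ρW.kernel x y) u v := by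
  obtain ⟨a, b, ha, hb⟩ := exists_isGramKernel_kernel hmoment
  have hhalf : ((2⁻¹ : ℂ) • b : Lp AuxSpace 2 (volume : Measure ℝ)) =ᵐ[volume]
      fun E : ℝ => (2⁻¹ * E : ℂ) • a E := by
    filter_upwards [Lp.coeFn_smul (2⁻¹ : ℂ) b, hb] with E h hE
    rw [h, Pi.smul_apply, hE, smul_smul]
  obtain ⟨u, v, h⟩ := (ha.mul_left hhalf).exists_add (ha.mul_right hhalf)
  refine ⟨u, v, ?_⟩
  filter_upwards [h] with z hz
  rw [← hz, midpoint_eq_smul_add, smul_eq_mul]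
  simp only [map_mul, map_inv₀, Complex.conj_ofNat, Complex.conj_ofReal, invOf_eq_inv]
  push_cast
  ring

lemma gammaInt_eq (hmoment : FiniteSecondMoment ρW.energyDensity)
    (hwigner : ∀ᵐ t : ℝ, Integrable fun E : ℝ => (E : ℂ) * ρW.wigner E t) (ω : ℝ) :
    gammaInt ω ρW = ρW.coherenceMoment 0 (-ω) := by
  obtain ⟨a, -, ha, -⟩ := exists_isGramKernel_kernel hmoment
  have h := integral_exp_mul_integral_mul_wigner (g := fun _ => 1)
    (by simpa only [one_mul] using ha)
    (by simpa only [one_mul] using hwigner.mono fun _ => integrable_wigner hmoment) ω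
  simp only [one_mul] at h
  simp only [coherenceMoment, pow_zero, one_mul, ← h, gammaInt]
  congr 1 with t
  rw [integral_mul_const, mul_comm]

lemma integral_integral_energy_mul_wigner_mul (hmoment : FiniteSecondMoment ρW.energyDensity)
    (hwigner : ∀ᵐ t : ℝ, Integrable fun E : ℝ => (E : ℂ) * ρW.wigner E t) (ω : ℝ) (c d : ℂ) :
    ∫ t : ℝ, ∫ E : ℝ, (E : ℂ) * ρW.wigner E t * (Complex.exp (Complex.I * ω * t) * c +
        Complex.exp (-(Complex.I * ω * t)) * d) =
      c * ρW.coherenceMoment 1 (-ω) + d * ρW.coherenceMoment 1 ω := by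
  obtain ⟨u, v, h⟩ := exists_isGramKernel_midpoint_mul_kernel hmoment
  have hint : ∀ ω' : ℝ, Integrable fun t : ℝ =>
      Complex.exp (Complex.I * ω' * t) * ∫ E : ℝ, (E : ℂ) * ρW.wigner E t := by
    intro ω'
    have hexp : Continuous fun t : ℝ => Complex.exp (Complex.I * ω' * t) := by fun_prop
    refine (integrable_integral_mul_wigner h hwigner).bdd_mul (c := 1) hexp.aestronglyMeasurable
      (Eventually.of_forall fun t => ?_)
    rw [mul_assoc, ← Complex.ofReal_mul, Complex.norm_exp_I_mul_ofReal]
  have hmom : ∀ ω' : ℝ, ∫ t : ℝ, Complex.exp (Complex.I * ω' * t) *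
      ∫ E : ℝ, (E : ℂ) * ρW.wigner E t = ρW.coherenceMoment 1 (-ω') := fun ω' => by
    simpa only [coherenceMoment, pow_one] using integral_exp_mul_integral_mul_wigner h hwigner ω'
  have hneg := hmom (-ω)
  rw [neg_neg] at hneg
  rw [← hmom ω, ← hneg, ← integral_const_mul, ← integral_const_mul,
    ← integral_add ((hint ω).const_mul c) ((hint (-ω)).const_mul d)]
  congr 1 with t
  rw [integral_mul_const]
  push_cast
  simp only [mul_neg, neg_mul]
  ring

variable {ω : ℝ}

/-- The complex number `μ = (1/ω) ∫ dt ∫ dE E W(E,t) e^{iωt} / γ`, by which `η` and `ξ` are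
expressed. -/
def relMoment (ω : ℝ) (ρW : WeightState) : ℂ :=
  ρW.coherenceMoment 1 (-ω) / (ω * gammaInt ω ρW)

lemma star_relMoment :
    star (relMoment ω ρW) = ρW.coherenceMoment 1 ω / (ω * star (gammaInt ω ρW)) := by
  rw [relMoment, coherenceMoment_neg]
  simp only [Complex.star_def, map_div₀, map_mul, Complex.conj_ofReal, Complex.conj_conj]

lemma etaInt_eq (hmoment : FiniteSecondMoment ρW.energyDensity)
    (hwigner : ∀ᵐ t : ℝ, Integrable fun E : ℝ => (E : ℂ) * ρW.wigner E t) :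
    etaInt ω ρW = relMoment ω ρW + star (relMoment ω ρW) := by
  rw [etaInt, integral_integral_energy_mul_wigner_mul hmoment hwigner, star_relMoment, relMoment]
  simp only [div_eq_mul_inv, mul_inv]
  ring

lemma xiInt_eq (hmoment : FiniteSecondMoment ρW.energyDensity)
    (hwigner : ∀ᵐ t : ℝ, Integrable fun E : ℝ => (E : ℂ) * ρW.wigner E t) (ε₀ ε₁ : ℝ) :
    xiInt ω ε₀ ε₁ ρW = ε₁ * relMoment ω ρW - ε₀ * star (relMoment ω ρW) := by
  have h := integral_integral_energy_mul_wigner_mul hmoment hwigner ω (ε₁ / gammaInt ω ρW)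
    (-(ε₀ / star (gammaInt ω ρW)))
  simp only [mul_neg, ← sub_eq_add_neg, neg_mul] at h
  rw [xiInt, h, star_relMoment, relMoment]
  simp only [div_eq_mul_inv, mul_inv]
  ring

end WeightState

/-! ### Moments of the final state -/

section Integral

variable {α n 𝕜 : Type*} [Fintype n] [RCLike 𝕜]

lemma integrable_mul_mul_apply [MeasurableSpace α] {ν : Measure α} {M : α → Matrix n n 𝕜}
    (hM : ∀ j l, Integrable (fun x => M x j l) ν) (A B : Matrix n n 𝕜) (i k : n) :
    Integrable (fun x => (A * M x * B) i k) ν := by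
  simp only [Matrix.mul_apply]
  exact integrable_finsetSum _ fun l _ =>
    (integrable_finsetSum _ fun j _ => (hM j l).const_mul _).mul_const _

lemma integral_mul_mul_apply [MeasurableSpace α] {ν : Measure α} {M : α → Matrix n n 𝕜}
    (hM : ∀ j l, Integrable (fun x => M x j l) ν) (A B : Matrix n n 𝕜) (i k : n) :
    ∫ x, (A * M x * B) i k ∂ν = (A * Matrix.of (fun j l => ∫ x, M x j l ∂ν) * B) i k := by
  simp only [Matrix.mul_apply, Matrix.of_apply]
  rw [integral_finsetSum _ fun l _ =>
    (integrable_finsetSum _ fun j _ => (hM j l).const_mul _).mul_const _]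
  congr 1 with l
  rw [integral_mul_const, integral_finsetSum _ fun j _ => (hM j l).const_mul _]
  simp only [integral_const_mul]

variable {g : ℝ → 𝕜} {m : ℕ}

lemma pow_mul_comp_add (g : ℝ → 𝕜) (m : ℕ) (c x : ℝ) :
    (x : 𝕜) ^ m * g (x + c) = (fun y : ℝ => ∑ k ∈ Finset.range (m + 1),
      (m.choose k * (-c) ^ (m - k) : 𝕜) * ((y : 𝕜) ^ k * g y)) (x + c) := by
  have hx : (x : 𝕜) = ((x + c : ℝ) : 𝕜) + -c := by push_cast; ring
  rw [hx, add_pow, Finset.sum_mul]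
  exact Finset.sum_congr rfl fun k _ => by ring

lemma integrable_pow_mul_comp_add (hg : ∀ k ≤ m, Integrable fun x : ℝ => (x : 𝕜) ^ k * g x)
    (c : ℝ) : Integrable fun x : ℝ => (x : 𝕜) ^ m * g (x + c) := by
  simp only [pow_mul_comp_add g m c]
  exact (integrable_finsetSum _ fun k hk =>
    (hg k (Finset.mem_range_succ_iff.1 hk)).const_mul _).comp_add_right c

lemma integral_pow_mul_comp_add (hg : ∀ k ≤ m, Integrable fun x : ℝ => (x : 𝕜) ^ k * g x)
    (c : ℝ) : ∫ x : ℝ, (x : 𝕜) ^ m * g (x + c) = ∑ k ∈ Finset.range (m + 1),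
      (m.choose k * (-c) ^ (m - k) : 𝕜) * ∫ x : ℝ, (x : 𝕜) ^ k * g x := by
  simp only [pow_mul_comp_add g m c]
  rw [integral_add_right_eq_self fun y : ℝ => ∑ k ∈ Finset.range (m + 1),
    (m.choose k * (-c) ^ (m - k) : 𝕜) * ((y : 𝕜) ^ k * g y), integral_finsetSum _ fun k hk =>
      (hg k (Finset.mem_range_succ_iff.1 hk)).const_mul _]
  simp only [integral_const_mul]

end Integral

section FinalState

open scoped Matrix
open WeightState

variable {ω : ℝ} {ρS V : Matrix (Fin 2) (Fin 2) ℂ} {ρW : WeightState} {m : ℕ}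

/-- The state `S (ρ_S ⊗ ρ_W) S†`, at equal energies of the weight, as a matrix over the qubit. -/
def shiftedState (ω : ℝ) (ρS : Matrix (Fin 2) (Fin 2) ℂ) (ρW : WeightState) (E : ℝ) :
    Matrix (Fin 2) (Fin 2) ℂ :=
  Matrix.of fun j l => ρS j l * ρW.kernel (E - level ω j) (E - level ω l)

/-- The matrix `Tr_W[H_Wᵐ S (ρ_S ⊗ ρ_W) S†]`. -/
def shiftMoment (ω : ℝ) (ρS : Matrix (Fin 2) (Fin 2) ℂ) (ρW : WeightState) (m : ℕ) :
    Matrix (Fin 2) (Fin 2) ℂ :=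
  Matrix.of fun j l => ∫ E : ℝ, ((E : ℂ) ^ m • shiftedState ω ρS ρW E) j l

lemma controlMarginal_eq_shiftMoment : controlMarginal ω ρS ρW = shiftMoment ω ρS ρW 0 := by
  ext i j
  simp only [controlMarginal, traceWeight, conjugate, adj, mulLeft, opS, controlledShift,
    productState, shiftMoment, shiftedState, Matrix.of_apply, star_star, one_mul, pow_zero,
    one_smul]

lemma weightEnergyDensity_finalState (V : Matrix (Fin 2) (Fin 2) ℂ) (E : ℝ) :
    weightEnergyDensity (finalState ω ρS ρW V) E =
      (∑ i, (V * shiftedState ω ρS ρW (E + level ω i) * Vᴴ) i i).re := by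
  rw [weightEnergyDensity, Complex.re_sum]
  congr 1 with i
  congr 1
  simp only [finalState, conjugate, adj, mulLeft, protocolU, opSDagger, opS, onQubit,
    controlledShift, productState, shiftedState, Matrix.of_apply, Fin.sum_univ_two,
    Matrix.mul_apply, Matrix.conjTranspose_apply, star_add, star_mul', star_star, neg_mul, one_mul,
    sub_neg_eq_add]
  ring

lemma weightEnergyDensity_productState :
    weightEnergyDensity (productState ρS ρW) = weightEnergyDensity (finalState ω ρS ρW 1) := by
  ext E
  rw [weightEnergyDensity_finalState, weightEnergyDensity, Complex.re_sum]
  simp only [Matrix.conjTranspose_one, one_mul, mul_one, shiftedState, productState,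
    Matrix.of_apply, add_sub_cancel_right]

lemma integrable_pow_smul_shiftedState (hmoment : FiniteSecondMoment ρW.energyDensity)
    (hm : m ≤ 2) (j l : Fin 2) :
    Integrable fun E : ℝ => ((E : ℂ) ^ m • shiftedState ω ρS ρW E) j l := by
  simp only [Matrix.smul_apply, shiftedState, Matrix.of_apply, smul_eq_mul,
    mul_left_comm _ (ρS j l), sub_eq_add_neg]
  exact (integrable_pow_mul_kernel hmoment hm _ _).const_mul _

lemma integrable_pow_mul_conj_shiftedState (hmoment : FiniteSecondMoment ρW.energyDensity)
    (hm : m ≤ 2) (V : Matrix (Fin 2) (Fin 2) ℂ) (i : Fin 2) :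
    Integrable fun E : ℝ => (E : ℂ) ^ m * (V * shiftedState ω ρS ρW E * Vᴴ) i i := by
  simpa only [Matrix.mul_smul, Matrix.smul_mul, Matrix.smul_apply, smul_eq_mul] using
    integrable_mul_mul_apply (integrable_pow_smul_shiftedState hmoment hm) V Vᴴ i i

lemma integral_pow_mul_conj_shiftedState (hmoment : FiniteSecondMoment ρW.energyDensity)
    (hm : m ≤ 2) (V : Matrix (Fin 2) (Fin 2) ℂ) (i : Fin 2) :
    ∫ E : ℝ, (E : ℂ) ^ m * (V * shiftedState ω ρS ρW E * Vᴴ) i i =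
      (V * shiftMoment ω ρS ρW m * Vᴴ) i i := by
  rw [shiftMoment, ← integral_mul_mul_apply (integrable_pow_smul_shiftedState hmoment hm)]
  simp only [Matrix.mul_smul, Matrix.smul_mul, Matrix.smul_apply, smul_eq_mul]

lemma pow_mul_weightEnergyDensity_finalState (m : ℕ) (V : Matrix (Fin 2) (Fin 2) ℂ) (E : ℝ) :
    E ^ m * weightEnergyDensity (finalState ω ρS ρW V) E =
      RCLike.re (∑ i, (E : ℂ) ^ m * (V * shiftedState ω ρS ρW (E + level ω i) * Vᴴ) i i) := by
  rw [weightEnergyDensity_finalState, ← Finset.mul_sum, ← Complex.ofReal_pow,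
    RCLike.re_eq_complex_re, Complex.re_ofReal_mul]

lemma integrable_pow_mul_translate (hmoment : FiniteSecondMoment ρW.energyDensity) (hm : m ≤ 2)
    (V : Matrix (Fin 2) (Fin 2) ℂ) (i : Fin 2) :
    Integrable fun E : ℝ =>
      (E : ℂ) ^ m * (V * shiftedState ω ρS ρW (E + level ω i) * Vᴴ) i i :=
  integrable_pow_mul_comp_add (𝕜 := ℂ) (g := fun E => (V * shiftedState ω ρS ρW E * Vᴴ) i i)
    (fun _ hk => integrable_pow_mul_conj_shiftedState hmoment (hk.trans hm) V i) _

lemma integrable_pow_mul_weightEnergyDensity_finalState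
    (hmoment : FiniteSecondMoment ρW.energyDensity) (hm : m ≤ 2)
    (V : Matrix (Fin 2) (Fin 2) ℂ) :
    Integrable fun E => E ^ m * weightEnergyDensity (finalState ω ρS ρW V) E := by
  simp only [pow_mul_weightEnergyDensity_finalState]
  exact (integrable_finsetSum _ fun i _ => integrable_pow_mul_translate hmoment hm V i).re

lemma integral_pow_mul_weightEnergyDensity_finalState
    (hmoment : FiniteSecondMoment ρW.energyDensity) (hm : m ≤ 2)
    (V : Matrix (Fin 2) (Fin 2) ℂ) :
    ∫ E, E ^ m * weightEnergyDensity (finalState ω ρS ρW V) E =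
      (∑ i, ∑ k ∈ Finset.range (m + 1), (m.choose k * (-level ω i) ^ (m - k) : ℂ) *
        (V * shiftMoment ω ρS ρW k * Vᴴ) i i).re := by
  simp only [pow_mul_weightEnergyDensity_finalState]
  rw [integral_re (integrable_finsetSum _ fun i _ => integrable_pow_mul_translate hmoment hm V i),
    integral_finsetSum _ fun i _ => integrable_pow_mul_translate hmoment hm V i]
  refine congrArg Complex.re (Finset.sum_congr rfl fun i _ => ?_)
  refine (integral_pow_mul_comp_add (𝕜 := ℂ)
    (fun k hk => integrable_pow_mul_conj_shiftedState hmoment (hk.trans hm) V i) _).trans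
    (Finset.sum_congr rfl fun k hk => ?_)
  exact congrArg _ (integral_pow_mul_conj_shiftedState hmoment
    ((Finset.mem_range_succ_iff.1 hk).trans hm) V i)

lemma trace_conj_of_mem_unitaryGroup {n R : Type*} [Fintype n] [DecidableEq n] [CommRing R]
    [StarRing R] {V : Matrix n n R} (hV : V ∈ Matrix.unitaryGroup n R) (M : Matrix n n R) :
    (V * M * Vᴴ).trace = M.trace := by
  rw [Matrix.trace_mul_cycle, ← Matrix.star_eq_conjTranspose, Matrix.mem_unitaryGroup_iff'.1 hV,
    one_mul]

lemma mean_weightEnergyDensity_finalState (hmoment : FiniteSecondMoment ρW.energyDensity)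
    (hV : V ∈ Matrix.unitaryGroup (Fin 2) ℂ) :
    mean (weightEnergyDensity (finalState ω ρS ρW V)) =
      ((shiftMoment ω ρS ρW 1).trace - ω * (V * shiftMoment ω ρS ρW 0 * Vᴴ) 1 1).re := by
  have h := integral_pow_mul_weightEnergyDensity_finalState (ω := ω) (ρS := ρS) hmoment
    (m := 1) (by norm_num) V
  simp only [pow_one] at h
  rw [mean, h, ← trace_conj_of_mem_unitaryGroup hV, Matrix.trace_fin_two]
  simp only [Fin.sum_univ_two, Finset.sum_range_succ, Finset.sum_range_zero, level,
    Matrix.cons_val_zero, Matrix.cons_val_one]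
  norm_num
  ring

lemma integral_sq_mul_weightEnergyDensity_finalState
    (hmoment : FiniteSecondMoment ρW.energyDensity) (hV : V ∈ Matrix.unitaryGroup (Fin 2) ℂ) :
    ∫ E, E ^ 2 * weightEnergyDensity (finalState ω ρS ρW V) E =
      ((shiftMoment ω ρS ρW 2).trace - 2 * ω * (V * shiftMoment ω ρS ρW 1 * Vᴴ) 1 1 +
        ω ^ 2 * (V * shiftMoment ω ρS ρW 0 * Vᴴ) 1 1).re := by
  rw [integral_pow_mul_weightEnergyDensity_finalState hmoment le_rfl,
    ← trace_conj_of_mem_unitaryGroup hV, Matrix.trace_fin_two]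
  congr 1
  simp only [Fin.sum_univ_two, Finset.sum_range_succ, Finset.sum_range_zero, level,
    Matrix.cons_val_zero, Matrix.cons_val_one]
  norm_num
  ring

/-- The combination `μ N⊥ σ N + μ* N σ N⊥ + (N σ + σ N) / 2` of a projection `N` and a state `σ`,
in which the first energy moment of the shifted state is expressed. -/
def momentForm {A : Type*} [Ring A] [Algebra ℂ A] (N : A) (μ : ℂ) (σ : A) : A :=
  μ • ((1 - N) * σ * N) + star μ • (N * σ * (1 - N)) + (2⁻¹ : ℂ) • (N * σ + σ * N)

/-- The projection `|1⟩⟨1|`. -/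
def excited : Matrix (Fin 2) (Fin 2) ℂ := !![0, 0; 0, 1]

lemma momentForm_excited (μ : ℂ) (σ : Matrix (Fin 2) (Fin 2) ℂ) :
    momentForm excited μ σ = !![0, (μ + 2⁻¹) * σ 0 1; (star μ + 2⁻¹) * σ 1 0, σ 1 1] := by
  rw [Matrix.eta_fin_two σ, momentForm, excited, Matrix.one_fin_two]
  ext i j
  fin_cases i <;> fin_cases j <;> simp <;> ring

lemma shiftMoment_apply (hmoment : FiniteSecondMoment ρW.energyDensity) (hm : m ≤ 2)
    (j l : Fin 2) : shiftMoment ω ρS ρW m j l = ρS j l * ∑ k ∈ Finset.range (m + 1),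
      (m.choose k * ((level ω j + level ω l) / 2) ^ (m - k) : ℂ) *
        ρW.coherenceMoment k (level ω j - level ω l) := by
  let c : ℝ := (level ω j + level ω l) / 2
  have hint := fun k (hk : k ≤ m) => integrable_pow_mul_kernel hmoment (hk.trans hm)
    (-((level ω j - level ω l) / 2)) ((level ω j - level ω l) / 2)
  have h := integral_pow_mul_comp_add (𝕜 := ℂ) hint (-c)
  have hleft : ∀ E, E + -c + -((level ω j - level ω l) / 2) = E - level ω j := fun E => by
    simp only [c]; ring
  have hright : ∀ E, E + -c + (level ω j - level ω l) / 2 = E - level ω l := fun E => by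
    simp only [c]; ring
  simp only [hleft, hright, Complex.coe_algebraMap] at h
  simp only [shiftMoment, shiftedState, Matrix.of_apply, Matrix.smul_apply, smul_eq_mul,
    mul_left_comm _ (ρS j l), integral_const_mul, coherenceMoment, sub_eq_add_neg]
  simp only [sub_eq_add_neg] at h
  rw [h]
  simp only [c]
  push_cast
  simp only [neg_neg]

lemma shiftMoment_one (hω : ω ≠ 0) (hmoment : FiniteSecondMoment ρW.energyDensity)
    (hmean : mean ρW.energyDensity = 0)
    (hwigner : ∀ᵐ t : ℝ, Integrable fun E : ℝ => (E : ℂ) * ρW.wigner E t)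
    (hγ : gammaInt ω ρW ≠ 0) :
    shiftMoment ω ρS ρW 1 =
      (ω : ℂ) • momentForm excited (relMoment ω ρW) (controlMarginal ω ρS ρW) := by
  have hωc : (ω : ℂ) ≠ 0 := Complex.ofReal_ne_zero.2 hω
  have hγ' : star (gammaInt ω ρW) ≠ 0 := star_ne_zero.2 hγ
  have hneg : ρW.coherenceMoment 1 (-ω) =
      ω * relMoment ω ρW * ρW.coherenceMoment 0 (-ω) := by
    rw [← gammaInt_eq hmoment hwigner, relMoment]
    field_simp
  have hpos : ρW.coherenceMoment 1 ω = ω * star (relMoment ω ρW) * ρW.coherenceMoment 0 ω := by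
    have hstar : ρW.coherenceMoment 0 ω = star (gammaInt ω ρW) := by
      rw [gammaInt_eq hmoment hwigner, coherenceMoment_neg, star_star]
    rw [hstar, star_relMoment]
    field_simp
  have hzero := coherenceMoment_one_zero hmean
  rw [controlMarginal_eq_shiftMoment]
  ext j l
  fin_cases j <;> fin_cases l <;>
    simp [momentForm_excited, shiftMoment_apply hmoment, Finset.sum_range_succ, level, hneg, hpos,
      hzero] <;>
    ring

lemma deltaEnergy_div (hω : ω ≠ 0) (hmoment : FiniteSecondMoment ρW.energyDensity)
    (hV : V ∈ Matrix.unitaryGroup (Fin 2) ℂ) :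
    deltaEnergy ω ρS ρW V / ω =
      (controlMarginal ω ρS ρW 1 1).re - ((V * controlMarginal ω ρS ρW * Vᴴ) 1 1).re := by
  rw [deltaEnergy, weightEnergyDensity_productState (ω := ω),
    mean_weightEnergyDensity_finalState hmoment hV,
    mean_weightEnergyDensity_finalState hmoment (one_mem _), ← controlMarginal_eq_shiftMoment]
  simp only [Matrix.conjTranspose_one, one_mul, mul_one, Complex.sub_re, Complex.re_ofReal_mul]
  field_simp
  ring

lemma deltaVariance_div (hω : ω ≠ 0) (hmoment : FiniteSecondMoment ρW.energyDensity)
    (hmean : mean ρW.energyDensity = 0)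
    (hwigner : ∀ᵐ t : ℝ, Integrable fun E : ℝ => (E : ℂ) * ρW.wigner E t)
    (hγ : gammaInt ω ρW ≠ 0) (hV : V ∈ Matrix.unitaryGroup (Fin 2) ℂ) :
    deltaVariance ω ρS ρW V / ω ^ 2 = 2 * ((controlMarginal ω ρS ρW 1 1).re -
        ((V * momentForm excited (relMoment ω ρW) (controlMarginal ω ρS ρW) * Vᴴ) 1 1).re) -
      deltaEnergy ω ρS ρW V / ω - (deltaEnergy ω ρS ρW V / ω) ^ 2 := by
  set σ := controlMarginal ω ρS ρW
  have hF : momentForm excited (relMoment ω ρW) σ 1 1 = σ 1 1 := by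
    rw [momentForm_excited]
    rfl
  have htrace : (shiftMoment ω ρS ρW 1).trace = ω * σ 1 1 := by
    rw [shiftMoment_one hω hmoment hmean hwigner hγ, momentForm_excited, Matrix.trace_smul,
      Matrix.trace_fin_two_of, zero_add, smul_eq_mul]
  have hmeanFinal : ∀ U ∈ Matrix.unitaryGroup (Fin 2) ℂ,
      ∫ E, E * weightEnergyDensity (finalState ω ρS ρW U) E =
        ω * ((σ 1 1).re - ((U * σ * Uᴴ) 1 1).re) := fun U hU => by
    rw [← mean, mean_weightEnergyDensity_finalState hmoment hU, htrace, ← mul_sub,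
      Complex.re_ofReal_mul, Complex.sub_re, ← controlMarginal_eq_shiftMoment]
  have hsqFinal : ∀ U ∈ Matrix.unitaryGroup (Fin 2) ℂ,
      ∫ E, E ^ 2 * weightEnergyDensity (finalState ω ρS ρW U) E =
        (shiftMoment ω ρS ρW 2).trace.re + ω ^ 2 * (((U * σ * Uᴴ) 1 1).re -
          2 * ((U * momentForm excited (relMoment ω ρW) σ * Uᴴ) 1 1).re) := fun U hU => by
    rw [integral_sq_mul_weightEnergyDensity_finalState hmoment hU,
      shiftMoment_one hω hmoment hmean hwigner hγ, ← controlMarginal_eq_shiftMoment,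
      Matrix.mul_smul, Matrix.smul_mul, Matrix.smul_apply, smul_eq_mul, Complex.add_re,
      Complex.sub_re, ← Complex.re_ofReal_mul, ← mul_assoc, ← Complex.ofReal_ofNat]
    simp only [← Complex.ofReal_mul, ← Complex.ofReal_pow, Complex.re_ofReal_mul]
    ring
  rw [deltaEnergy_div hω hmoment hV, deltaVariance, variance, variance,
    weightEnergyDensity_productState (ω := ω), hmeanFinal V hV, hmeanFinal 1 (one_mem _),
    hsqFinal V hV, hsqFinal 1 (one_mem _)]
  simp only [Matrix.conjTranspose_one, one_mul, mul_one, hF]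
  field_simp
  ring

end FinalState

/-! ### The work-variance phase space -/

section PhaseSpace

open scoped Matrix
open WeightState

variable {ω p a b : ℝ} {ρS P Q : Matrix (Fin 2) (Fin 2) ℂ} {ρW : WeightState}

lemma conj_hermitian_apply_one_one_re (P : Matrix (Fin 2) (Fin 2) ℂ) (s t : ℝ) (k : ℂ) :
    ((P * !![(s : ℂ), k; star k, (t : ℂ)] * Pᴴ) 1 1).re =
      s * ‖P 1 0‖ ^ 2 + t * ‖P 1 1‖ ^ 2 + 2 * (k * (P 1 0 * star (P 1 1))).re := by
  simp only [Matrix.mul_apply, Fin.sum_univ_two, Matrix.conjTranspose_apply, Matrix.of_apply,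
    Matrix.cons_val', Matrix.cons_val_zero, Matrix.cons_val_one, Matrix.cons_val_fin_one,
    ← Complex.normSq_eq_norm_sq, Complex.normSq_apply, Complex.star_def, Complex.add_re,
    Complex.mul_re, Complex.mul_im, Complex.add_im, Complex.conj_re, Complex.conj_im,
    Complex.ofReal_re, Complex.ofReal_im]
  ring

lemma norm_sq_add_norm_sq_of_mem_unitaryGroup (hP : P ∈ Matrix.unitaryGroup (Fin 2) ℂ)
    (i : Fin 2) : ‖P i 0‖ ^ 2 + ‖P i 1‖ ^ 2 = 1 := by
  have h := congrFun (congrFun (Matrix.mem_unitaryGroup_iff.1 hP) i) i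
  rw [Matrix.mul_apply, Fin.sum_univ_two, Matrix.star_apply, Matrix.star_apply, Complex.star_def,
    Complex.mul_conj', Complex.mul_conj', Matrix.one_apply_eq] at h
  exact_mod_cast h

lemma map_momentForm {A B : Type*} [Ring A] [Algebra ℂ A] [Ring B] [Algebra ℂ B] (f : A →ₐ[ℂ] B)
    (N : A) (μ : ℂ) (σ : A) : f (momentForm N μ σ) = momentForm (f N) μ (f σ) := by
  simp only [momentForm, map_add, map_smul, map_mul, map_sub, map_one]

lemma momentForm_conj {A : Type*} [Ring A] [StarRing A] [Algebra ℂ A] {u : A} (hu : u ∈ unitary A)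
    (N : A) (μ : ℂ) (σ : A) :
    momentForm N μ (u * σ * star u) = u * momentForm (star u * N * u) μ σ * star u := by
  let f := Unitary.conjStarAlgAut ℂ A ⟨u, hu⟩
  have hN : u * (star u * N * u) * star u = N := f.apply_symm_apply N
  simpa [f, hN] using (map_momentForm (f : A →ₐ[ℂ] A) (f.symm N) μ σ).symm

lemma conjTranspose_mul_excited_mul (Q : Matrix (Fin 2) (Fin 2) ℂ) :
    Qᴴ * excited * Q = !![((‖Q 1 0‖ ^ 2 : ℝ) : ℂ), star (Q 1 0) * Q 1 1;
      star (star (Q 1 0) * Q 1 1), ((‖Q 1 1‖ ^ 2 : ℝ) : ℂ)] := by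
  rw [Matrix.eta_fin_two (Qᴴ * excited * Q)]
  simp [Matrix.mul_apply, excited, ← Complex.conj_mul', mul_comm]

lemma momentForm_diagonal (hab : a + b = 1) {c : ℂ} (hc : ‖c‖ ^ 2 = a * b) (p : ℝ) (μ : ℂ) :
    momentForm !![(a : ℂ), c; star c, (b : ℂ)] μ !![(p : ℂ), 0; star 0, ((1 - p : ℝ) : ℂ)] =
      !![((p * a - (1 - 2 * p) * (a * b) * (2 * μ.re) : ℝ) : ℂ),
          2⁻¹ * (1 - 2 * (1 - 2 * p) * (b * μ - a * star μ)) * c;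
        star (2⁻¹ * (1 - 2 * (1 - 2 * p) * (b * μ - a * star μ)) * c),
          (((1 - p) * b + (1 - 2 * p) * (a * b) * (2 * μ.re) : ℝ) : ℂ)] := by
  obtain rfl : b = 1 - a := eq_sub_of_add_eq' hab
  have hc' : c * conj c = a * (1 - a) := by
    rw [Complex.mul_conj']
    exact_mod_cast hc
  have hμ : μ + conj μ = 2 * μ.re := by exact_mod_cast Complex.add_conj μ
  ext i j
  fin_cases i <;> fin_cases j <;>
    simp only [momentForm, Matrix.one_fin_two, Matrix.add_apply, Matrix.sub_apply,
      Matrix.smul_apply, Matrix.mul_apply, Fin.sum_univ_two, Matrix.of_apply, Matrix.cons_val',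
      Matrix.cons_val_zero, Matrix.cons_val_one, Matrix.cons_val_fin_one, Fin.zero_eta, Fin.mk_one,
      smul_eq_mul, Complex.star_def, map_sub, map_mul, map_inv₀, map_one, map_zero, map_ofNat,
      Complex.conj_ofReal, Complex.conj_conj] <;>
    push_cast
  · linear_combination -((1 - p) * (μ + conj μ)) * hc' - (1 - 2 * p) * (a * (1 - a)) * hμ
  · ring
  · ring
  · linear_combination -(p * (μ + conj μ)) * hc' + (1 - 2 * p) * (a * (1 - a)) * hμ

lemma conj_mul_conjTranspose {n R : Type*} [Fintype n] [DecidableEq n] [CommRing R] [StarRing R]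
    {U : Matrix n n R} (hU : U ∈ Matrix.unitaryGroup n R) (M X : Matrix n n R) :
    M * Uᴴ * (U * X * Uᴴ) * (M * Uᴴ)ᴴ = M * X * Mᴴ := by
  have hUU : Uᴴ * U = 1 := Matrix.mem_unitaryGroup_iff'.1 hU
  calc M * Uᴴ * (U * X * Uᴴ) * (M * Uᴴ)ᴴ = M * (Uᴴ * U) * X * (Uᴴ * U) * Mᴴ := by
        simp only [Matrix.conjTranspose_mul, Matrix.conjTranspose_conjTranspose, mul_assoc]
    _ = M * X * Mᴴ := by rw [hUU, mul_one, mul_one]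

/-- The unitary whose columns are the vectors of the orthonormal basis `ψ`. -/
def columns (ψ : OrthonormalBasis (Fin 2) ℂ (EuclideanSpace ℂ (Fin 2))) :
    Matrix (Fin 2) (Fin 2) ℂ :=
  Matrix.of fun i j => ψ j i

lemma columns_mem_unitaryGroup (ψ : OrthonormalBasis (Fin 2) ℂ (EuclideanSpace ℂ (Fin 2))) :
    columns ψ ∈ Matrix.unitaryGroup (Fin 2) ℂ := 
  (EuclideanSpace.basisFun (Fin 2) ℂ).toMatrix_orthonormalBasis_mem_unitary ψ

lemma smul_projector_add_smul_projector
    (ψ : OrthonormalBasis (Fin 2) ℂ (EuclideanSpace ℂ (Fin 2))) (p : ℝ) :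
    (p : ℂ) • projector (ψ 0) + (1 - (p : ℂ)) • projector (ψ 1) =
      columns ψ * !![(p : ℂ), 0; star 0, ((1 - p : ℝ) : ℂ)] * (columns ψ)ᴴ := by
  ext i j
  simp only [projector, columns, Matrix.add_apply, Matrix.smul_apply, Matrix.mul_apply,
    Fin.sum_univ_two, Matrix.conjTranspose_apply, Matrix.of_apply, Matrix.cons_val',
    Matrix.cons_val_zero, Matrix.cons_val_one, Matrix.cons_val_fin_one, smul_eq_mul, star_zero]
  push_cast
  ring

lemma relEnergy_eq (hω : ω ≠ 0) (φ : EuclideanSpace ℂ (Fin 2)) : relEnergy ω φ = ‖φ 1‖ ^ 2 := by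
  have hexcited : star (φ 1) * (ω : ℂ) * φ 1 = ((ω * ‖φ 1‖ ^ 2 : ℝ) : ℂ) := by
    rw [mul_right_comm, Complex.star_def, Complex.conj_mul', mul_comm]
    push_cast
    rfl
  simp only [relEnergy, hamiltonian, Fin.sum_univ_two, level, Matrix.diagonal_apply_eq,
    Matrix.diagonal_apply_ne _ zero_ne_one, Matrix.diagonal_apply_ne _ one_ne_zero,
    Matrix.cons_val_zero, Matrix.cons_val_one, mul_zero, zero_mul, add_zero, zero_add,
    Complex.ofReal_zero, hexcited, Complex.ofReal_re]
  field_simp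

lemma deltaEnergy_div_mul_conjTranspose (hω : ω ≠ 0)
    (hmoment : FiniteSecondMoment ρW.energyDensity)
    (hσ : controlMarginal ω ρS ρW = Q * !![(p : ℂ), 0; star 0, ((1 - p : ℝ) : ℂ)] * Qᴴ)
    (hQ : Q ∈ Matrix.unitaryGroup (Fin 2) ℂ) (hP : P ∈ Matrix.unitaryGroup (Fin 2) ℂ) :
    deltaEnergy ω ρS ρW (P * Qᴴ) / ω = (1 - 2 * p) * (‖P 1 0‖ ^ 2 - ‖Q 1 0‖ ^ 2) := by
  have hV : P * Qᴴ ∈ Matrix.unitaryGroup (Fin 2) ℂ := mul_mem hP (Unitary.star_mem hQ)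
  rw [deltaEnergy_div hω hmoment hV, hσ, conj_mul_conjTranspose hQ,
    conj_hermitian_apply_one_one_re, conj_hermitian_apply_one_one_re, zero_mul, zero_mul,
    Complex.zero_re]
  linear_combination (1 - p) * (norm_sq_add_norm_sq_of_mem_unitaryGroup hQ 1 -
    norm_sq_add_norm_sq_of_mem_unitaryGroup hP 1)

lemma fCentre_mul_sub (hp : 1 - 2 * p ≠ 0) (hab : a + b = 1) (η q : ℝ) :
    fCentre p a b η ((1 - 2 * p) * (q - a)) =
      2 * (p * a + (1 - p) * b - ((p * a - (1 - 2 * p) * (a * b) * η) * q +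
        ((1 - p) * b + (1 - 2 * p) * (a * b) * η) * (1 - q))) -
      (1 - 2 * p) * (q - a) - ((1 - 2 * p) * (q - a)) ^ 2 := by
  obtain rfl : b = 1 - a := eq_sub_of_add_eq' hab
  rw [fCentre]
  field_simp
  ring

lemma deltaVariance_div_mul_conjTranspose (hω : ω ≠ 0)
    (hmoment : FiniteSecondMoment ρW.energyDensity) (hmean : mean ρW.energyDensity = 0)
    (hwigner : ∀ᵐ t : ℝ, Integrable fun E : ℝ => (E : ℂ) * ρW.wigner E t)
    (hγ : gammaInt ω ρW ≠ 0) (hp : 1 - 2 * p ≠ 0)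
    (hσ : controlMarginal ω ρS ρW = Q * !![(p : ℂ), 0; star 0, ((1 - p : ℝ) : ℂ)] * Qᴴ)
    (hQ : Q ∈ Matrix.unitaryGroup (Fin 2) ℂ) (hP : P ∈ Matrix.unitaryGroup (Fin 2) ℂ) :
    deltaVariance ω ρS ρW (P * Qᴴ) / ω ^ 2 =
      fCentre p (‖Q 1 0‖ ^ 2) (‖Q 1 1‖ ^ 2) (etaInt ω ρW).re
          ((1 - 2 * p) * (‖P 1 0‖ ^ 2 - ‖Q 1 0‖ ^ 2)) -
        2 * ((1 - 2 * (1 - 2 * p) * xiInt ω (‖Q 1 0‖ ^ 2) (‖Q 1 1‖ ^ 2) ρW) *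
          (star (Q 1 0) * Q 1 1) * (P 1 0 * star (P 1 1))).re := by
  have hV : P * Qᴴ ∈ Matrix.unitaryGroup (Fin 2) ℂ := mul_mem hP (Unitary.star_mem hQ)
  have hrow := norm_sq_add_norm_sq_of_mem_unitaryGroup hQ 1
  have hq : ‖P 1 1‖ ^ 2 = 1 - ‖P 1 0‖ ^ 2 :=
    eq_sub_of_add_eq' (norm_sq_add_norm_sq_of_mem_unitaryGroup hP 1)
  have hη : (etaInt ω ρW).re = 2 * (relMoment ω ρW).re := by
    rw [etaInt_eq hmoment hwigner, Complex.star_def, Complex.add_conj, Complex.ofReal_re]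
  have hc : ‖star (Q 1 0) * Q 1 1‖ ^ 2 = ‖Q 1 0‖ ^ 2 * ‖Q 1 1‖ ^ 2 := by
    rw [norm_mul, norm_star, mul_pow]
  have hM (D : Matrix (Fin 2) (Fin 2) ℂ) : momentForm excited (relMoment ω ρW) (Q * D * Qᴴ) =
      Q * momentForm (Qᴴ * excited * Q) (relMoment ω ρW) D * Qᴴ := momentForm_conj hQ _ _ _
  rw [deltaVariance_div hω hmoment hmean hwigner hγ hV,
    deltaEnergy_div_mul_conjTranspose hω hmoment hσ hQ hP, hσ, hM, conj_mul_conjTranspose hQ,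
    conjTranspose_mul_excited_mul, momentForm_diagonal hrow hc, conj_hermitian_apply_one_one_re,
    conj_hermitian_apply_one_one_re, xiInt_eq hmoment hwigner, hη, hq]
  have hhalf (z : ℂ) : (2⁻¹ * z).re = z.re / 2 := by
    rw [inv_mul_eq_div, Complex.div_ofNat_re]
  simp only [mul_assoc (2⁻¹ : ℂ), hhalf, zero_mul, Complex.zero_re]
  rw [fCentre_mul_sub hp hrow]
  ring

lemma exists_norm_eq_one_re_mul {k : ℂ} {t : ℝ} (ht : |t| ≤ ‖k‖) :
    ∃ e : ℂ, ‖e‖ = 1 ∧ (k * e).re = t := by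
  have hcos : |t / ‖k‖| ≤ 1 := by
    rw [abs_div, abs_norm]
    exact div_le_one_of_le₀ ht (norm_nonneg k)
  have hk : k * Complex.exp ((Real.arccos (t / ‖k‖) - k.arg : ℝ) * Complex.I) =
      ‖k‖ * Complex.exp (Real.arccos (t / ‖k‖) * Complex.I) := by
    nth_rw 1 [← Complex.norm_mul_exp_arg_mul_I k]
    rw [mul_assoc, ← Complex.exp_add, ← add_mul, Complex.ofReal_sub, add_sub_cancel]
  refine ⟨_, Complex.norm_exp_ofReal_mul_I (Real.arccos (t / ‖k‖) - k.arg), ?_⟩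
  rw [hk, Complex.re_ofReal_mul, Complex.exp_ofReal_mul_I_re,
    Real.cos_arccos (abs_le.1 hcos).1 (abs_le.1 hcos).2]
  exact mul_div_cancel_of_imp' fun hk0 => abs_nonpos_iff.1 (hk0 ▸ ht)

lemma mem_unitaryGroup_of_row {v₀ v₁ : ℂ} (hv : ‖v₀‖ ^ 2 + ‖v₁‖ ^ 2 = 1) :
    !![star v₁, -star v₀; v₀, v₁] ∈ Matrix.unitaryGroup (Fin 2) ℂ := by
  have hdet : v₀ * star v₀ + v₁ * star v₁ = 1 := by
    rw [Complex.star_def, Complex.mul_conj', Complex.mul_conj']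
    exact_mod_cast hv
  have hstar : star !![star v₁, -star v₀; v₀, v₁] = !![v₁, star v₀; -v₀, star v₁] := by
    rw [Matrix.star_eq_conjTranspose, Matrix.eta_fin_two (Matrix.conjTranspose _)]
    simp
  rw [Matrix.mem_unitaryGroup_iff, hstar, Matrix.mul_fin_two, Matrix.one_fin_two]
  congr! 5
  · linear_combination hdet
  · ring
  · ring

lemma range_occupation_coherence (k : ℂ) :
    Set.range (fun P : Matrix.unitaryGroup (Fin 2) ℂ =>
        (‖P.1 1 0‖ ^ 2, (k * (P.1 1 0 * star (P.1 1 1))).re)) =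
      {x : ℝ × ℝ | x.1 ∈ Set.Icc 0 1 ∧ |x.2| ≤ ‖k‖ * √(x.1 * (1 - x.1))} := by
  ext ⟨q, t⟩
  simp only [Set.mem_range, Set.mem_ofPred_eq, Prod.mk.injEq, Set.mem_Icc]
  constructor
  · rintro ⟨P, rfl, rfl⟩
    have hrow := norm_sq_add_norm_sq_of_mem_unitaryGroup P.2 1
    refine ⟨⟨sq_nonneg _, by nlinarith [sq_nonneg ‖P.1 1 1‖]⟩, ?_⟩
    rw [← eq_sub_of_add_eq' hrow, ← mul_pow, Real.sqrt_sq (by positivity)]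
    refine (Complex.abs_re_le_norm _).trans_eq ?_
    rw [norm_mul, norm_mul, norm_star]
  · rintro ⟨⟨hq0, hq1⟩, ht⟩
    have hq1' : 0 ≤ 1 - q := sub_nonneg.2 hq1
    obtain ⟨e, he, rfl⟩ : ∃ e : ℂ, ‖e‖ = 1 ∧ (k * √(q * (1 - q)) * e).re = t :=
      exists_norm_eq_one_re_mul (by rwa [norm_mul, Complex.norm_of_nonneg (Real.sqrt_nonneg _)])
    have hA : ‖e * √q‖ ^ 2 = q := by
      rw [norm_mul, he, one_mul, Complex.norm_of_nonneg (Real.sqrt_nonneg _), Real.sq_sqrt hq0]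
    have hB : ‖(√(1 - q) : ℂ)‖ ^ 2 = 1 - q := by
      rw [Complex.norm_of_nonneg (Real.sqrt_nonneg _), Real.sq_sqrt hq1']
    have hrow : ‖e * √q‖ ^ 2 + ‖(√(1 - q) : ℂ)‖ ^ 2 = 1 := by rw [hA, hB, add_sub_cancel]
    refine ⟨⟨_, mem_unitaryGroup_of_row hrow⟩, hA, congrArg Complex.re ?_⟩
    simp only [Matrix.of_apply, Matrix.cons_val', Matrix.cons_val_zero, Matrix.cons_val_one,
      Matrix.cons_val_fin_one, Complex.star_def, Complex.conj_ofReal, Real.sqrt_mul hq0,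
      Complex.ofReal_mul]
    ring

lemma hWidth_mul_sub (hp : 1 - 2 * p ≠ 0) (hab : a + b = 1) (hab₀ : 0 ≤ a * b) (ξ : ℂ) (q : ℝ) :
    hWidth p a b ξ ((1 - 2 * p) * (q - a)) =
      2 * (radiusR p ξ * √(a * b) * √(q * (1 - q))) := by
  obtain rfl : b = 1 - a := eq_sub_of_add_eq' hab
  rw [hWidth, mul_div_cancel_left₀ _ hp, mul_assoc (a * _), Real.sqrt_mul hab₀, add_sub_cancel,
    sub_sub_sub_cancel_right]
  ring

lemma image_occupation_coherence (hp : p < 1 / 2) (hab : a + b = 1) (hab₀ : 0 ≤ a * b) (η : ℝ)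
    (ξ : ℂ) :
    (fun x : ℝ × ℝ => ((1 - 2 * p) * (x.1 - a),
        fCentre p a b η ((1 - 2 * p) * (x.1 - a)) - 2 * x.2)) ''
      {x : ℝ × ℝ | x.1 ∈ Set.Icc 0 1 ∧ |x.2| ≤ radiusR p ξ * √(a * b) * √(x.1 * (1 - x.1))} =
      {x : ℝ × ℝ | x.1 ∈ Set.Icc (-a * (1 - 2 * p)) (b * (1 - 2 * p)) ∧
        x.2 ∈ Set.Icc (fCentre p a b η x.1 - hWidth p a b ξ x.1)
          (fCentre p a b η x.1 + hWidth p a b ξ x.1)} := by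
  have hr : 0 < 1 - 2 * p := by linarith
  ext ⟨w, v⟩
  simp only [Set.mem_image, Set.mem_ofPred_eq, Prod.mk.injEq, Set.mem_Icc, Prod.exists]
  constructor
  · rintro ⟨q, t, ⟨⟨hq0, hq1⟩, ht⟩, rfl, rfl⟩
    rw [hWidth_mul_sub hr.ne' hab hab₀]
    obtain ⟨ht₁, ht₂⟩ := abs_le.1 ht
    exact ⟨⟨by nlinarith, by nlinarith⟩, by linarith, by linarith⟩
  · rintro ⟨⟨hw₁, hw₂⟩, hv₁, hv₂⟩
    obtain ⟨q, rfl⟩ : ∃ q, (1 - 2 * p) * (q - a) = w :=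
      ⟨w / (1 - 2 * p) + a, by rw [add_sub_cancel_right, mul_div_cancel₀ _ hr.ne']⟩
    rw [hWidth_mul_sub hr.ne' hab hab₀] at hv₁ hv₂
    refine ⟨q, (fCentre p a b η ((1 - 2 * p) * (q - a)) - v) / 2, ⟨⟨?_, ?_⟩, ?_⟩, rfl, by ring⟩
    · nlinarith
    · nlinarith
    · exact abs_le.2 ⟨by linarith, by linarith⟩

end PhaseSpace

end QubitWeight

end

open QubitWeight QubitWeight.WeightState in
theorem proposition2_general
    (ω : ℝ) (hω : ω ≠ 0)
    (ρS : Matrix (Fin 2) (Fin 2) ℂ)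
    (ρW : WeightState)
    (hmoment : FiniteSecondMoment ρW.energyDensity)
    (hmean : mean ρW.energyDensity = 0)
    (hwigner : ∀ᵐ t : ℝ, Integrable fun E : ℝ => (E : ℂ) * ρW.wigner E t)
    (hγ : gammaInt ω ρW ≠ 0)
    (p : ℝ) (hp : p < 1 / 2)
    (ψ : OrthonormalBasis (Fin 2) ℂ (EuclideanSpace ℂ (Fin 2)))
    (hσ : controlMarginal ω ρS ρW =
      (p : ℂ) • projector (ψ 0) + (1 - (p : ℂ)) • projector (ψ 1))
    (ε₀ ε₁ : ℝ)
    (hε₀ : ε₀ = relEnergy ω (ψ 0))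
    (hε₁ : ε₁ = relEnergy ω (ψ 1))
    (η ξ : ℂ)
    (hη : η = etaInt ω ρW)
    (hξ : ξ = xiInt ω ε₀ ε₁ ρW) :
    η.im = 0 ∧
    (∀ V : Matrix.unitaryGroup (Fin 2) ℂ, FiniteSecondMoment
      (weightEnergyDensity (finalState ω ρS ρW V))) ∧
    Set.range (fun V : Matrix.unitaryGroup (Fin 2) ℂ =>
        (deltaEnergy ω ρS ρW V / ω, deltaVariance ω ρS ρW V / ω ^ 2)) =
      {x : ℝ × ℝ |
        x.1 ∈ Set.Icc (-ε₀ * (1 - 2 * p)) (ε₁ * (1 - 2 * p)) ∧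
        x.2 ∈ Set.Icc
          (fCentre p ε₀ ε₁ η.re x.1 - hWidth p ε₀ ε₁ ξ x.1)
          (fCentre p ε₀ ε₁ η.re x.1 + hWidth p ε₀ ε₁ ξ x.1)} := by
  have hQ := columns_mem_unitaryGroup ψ
  rw [smul_projector_add_smul_projector] at hσ
  obtain rfl : ε₀ = ‖columns ψ 1 0‖ ^ 2 := hε₀.trans (relEnergy_eq hω _)
  obtain rfl : ε₁ = ‖columns ψ 1 1‖ ^ 2 := hε₁.trans (relEnergy_eq hω _)
  have hrow := norm_sq_add_norm_sq_of_mem_unitaryGroup hQ 1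
  refine ⟨?_, fun V =>
    integrable_pow_mul_weightEnergyDensity_finalState hmoment le_rfl V.1, ?_⟩
  · rw [hη, etaInt_eq hmoment hwigner, Complex.star_def, Complex.add_conj, Complex.ofReal_im]
  let k := (1 - 2 * (1 - 2 * (p : ℂ)) * ξ) * (star (columns ψ 1 0) * columns ψ 1 1)
  have hk : ‖k‖ = radiusR p ξ * √(‖columns ψ 1 0‖ ^ 2 * ‖columns ψ 1 1‖ ^ 2) := by
    rw [norm_mul, norm_mul, norm_star, ← mul_pow, Real.sqrt_sq (by positivity), radiusR]
  rw [← (Equiv.mulRight (star ⟨columns ψ, hQ⟩)).surjective.range_comp,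
    ← image_occupation_coherence hp hrow (by positivity), ← hk, ← range_occupation_coherence,
    ← Set.range_comp]
  refine congrArg Set.range (funext fun P => Prod.ext ?_ ?_)
  · exact deltaEnergy_div_mul_conjTranspose hω hmoment hσ hQ P.2
  · subst hη hξ
    exact deltaVariance_div_mul_conjTranspose hω hmoment hmean hwigner hγ (by linarith) hσ hQ P.2

theorem proposition2
    (ω : ℝ) (hω : 0 < ω)
    (ρS : Matrix (Fin 2) (Fin 2) ℂ) (hρS : ρS.PosSemidef) (htr : ρS.trace = 1)
    (ρW : QubitWeight.WeightState)
    (hmoment : QubitWeight.FiniteSecondMoment ρW.energyDensity)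
    (hmean : QubitWeight.mean ρW.energyDensity = 0)
    (hwigner : ρW.WignerMomentExists)
    (hγ : QubitWeight.gammaInt ω ρW ≠ 0)
    (p : ℝ) (hp : p < 1 / 2)
    (ψ : OrthonormalBasis (Fin 2) ℂ (EuclideanSpace ℂ (Fin 2)))
    (hσ : QubitWeight.controlMarginal ω ρS ρW =
      (p : ℂ) • QubitWeight.projector (ψ 0) + (1 - (p : ℂ)) • QubitWeight.projector (ψ 1))
    (ε₀ ε₁ : ℝ)
    (hε₀ : ε₀ = QubitWeight.relEnergy ω (ψ 0))
    (hε₁ : ε₁ = QubitWeight.relEnergy ω (ψ 1))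
    (η ξ : ℂ)
    (hη : η = QubitWeight.etaInt ω ρW)
    (hξ : ξ = QubitWeight.xiInt ω ε₀ ε₁ ρW) :
    η.im = 0 ∧
    (∀ V : Matrix.unitaryGroup (Fin 2) ℂ, QubitWeight.FiniteSecondMoment
      (QubitWeight.weightEnergyDensity (QubitWeight.finalState ω ρS ρW V))) ∧
    Set.range (fun V : Matrix.unitaryGroup (Fin 2) ℂ =>
        (QubitWeight.deltaEnergy ω ρS ρW V / ω, QubitWeight.deltaVariance ω ρS ρW V / ω ^ 2)) =
      {x : ℝ × ℝ |
        x.1 ∈ Set.Icc (-ε₀ * (1 - 2 * p)) (ε₁ * (1 - 2 * p)) ∧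
        x.2 ∈ Set.Icc
          (QubitWeight.fCentre p ε₀ ε₁ η.re x.1 - QubitWeight.hWidth p ε₀ ε₁ ξ x.1)
          (QubitWeight.fCentre p ε₀ ε₁ η.re x.1 + QubitWeight.hWidth p ε₀ ε₁ ξ x.1)} := by
  exact proposition2_general ω hω.ne' ρS ρW hmoment hmean hwigner.1 hγ p hp ψ hσ ε₀ ε₁ hε₀ hε₁ η ξ
    hη hξ
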